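/- Conventions. An integral quadratic form $\mathbf q$ in $m$ variables is $\mathbf q(X)=\sum_{i\le j}q_{ij}x_ix_j$ with $q_{ij}\in\mathbb Z$; its matrix is $Q=(q_{ij})+{}^t(q_{ij})$, $\det\mathbf q=\det Q$, and $\mathbf q[A](Y)=\mathbf q(AY)$. Put $R(\mathbf q,\mathbf q')=\{A \text{ integral}:\mathbf q[A]=\mathbf q'\}$, let $R^*(\mathbf q,\mathbf q')$ be the subset of matrices with coprime entries, and $E(\mathbf q)=R(\mathbf q,\mathbf q)\cap GL_m(\mathbb Z)$. Forms $\mathbf q,\mathbf q'$ are integrally equivalent if $\mathbf q'=\mathbf q[U]$ with $U\in GL_m(\mathbb Z)$; $\mathbf q'$ is similar to $\mathbf q$ if $\det\mathbf q=\det\mathbf q'$ and $R(\mathbf q,a\mathbf q')\neq\varnothing$ for some nonzero integer $a$ prime to $\det\mathbf q$. For a ternary form $\mathbf q$ on $E=\mathbb Z^3$ with standard basis $e_1,e_2,e_3$, let $C(E,\mathbf q)$ be the Clifford algebra ($x^2=\mathbf q(x)$ for $x\in E$), $x\mapsto\bar x$ its antiautomorphism with $\bar e_j=-e_j$, and $C_0(E,\mathbf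 q)$ its even subalgebra, with natural basis $1,\ e_2e_3,\ -e_1e_3,\ e_1e_2$. The norm $\mathbf n(x)=x\bar x\in\mathbb Z$ on $C_0(E,\mathbf q)$, written in the natural basis, is an integral quaternary form, called the norm form of $\mathbf q$. A matrix $A\in R(\mathbf q,\mathbf q'')$ (ternary forms) is an isometry $(\mathbb Z^3,\mathbf q'')\to(\mathbb Z^3,\mathbf q)$ and induces an algebra homomorphism $C_0(\mathbb Z^3,\mathbf q'')\to C_0(\mathbb Z^3,\mathbf q)$; let $\Phi_A$ be its matrix in the natural bases. For a prime $p$ and $A\in R(\mathbf q,p^2\mathbf q')$, regarded as an element of $R(\mathbf q,\mathbf q'')$ with $\mathbf q''=p^2\mathbf q'$, put $\Psi_A=\Phi_A\cdot\mathrm{diag}(p,p^{-1},p^{-1},p^{-1})$. Corollary 6.8. Let $\mathbf q$ be an integral nonsingular ternary quadratic form with norm form $\mathbf n$, let $\{\mathbf q_1,\dots,\mathbf q_h\}$ and $\{\mathbf n_1,\dots,\mathbf n_H\}$ be complete systems of representatives of the different classes of integrally equivalent forms in the similarity classes of $\mathbf q$ and of $\mathbf n$, and let $p$ be a prime coprime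 to $\det\mathbf q$. For $A\in R^*(\mathbf q_i,p^2\mathbf q)$ and $\mathcal M\in R(\mathbf n_j,p\mathbf n)$, the condition $\Psi_A\mathcal M^{-1}\in M_4(\mathbb Z)$ ("$\mathcal M$ divides $\Psi_A$ from the right") depends only on the classes $E(\mathbf q_i)A$ and $E(\mathbf n_j)\mathcal M$, and $$\bigcup_{j=1}^H E(\mathbf n_j)\backslash R(\mathbf n_j,p\mathbf n)=\bigcup_{A\in\bigcup_{i=1}^h E(\mathbf q_i)\backslash R^*(\mathbf q_i,p^2\mathbf q)}\Bigl\{\mathcal M\in\bigcup_{j=1}^H E(\mathbf n_j)\backslash R(\mathbf n_j,p\mathbf n)\ :\ \Psi_A\mathcal M^{-1}\in M_4(\mathbb Z)\Bigr\},$$ where for each fixed $A$ the set on the right consists of exactly $2$ classes and the union over $A$ is disjoint. In other words, every class of quaternary automorphs in $\bigcup_jE(\mathbf n_j)\backslash R(\mathbf n_j,p\mathbf n)$ divides $\Psi_A$ from the right for exactly one class $A\in\bigcup_iE(\mathbf q_i)\backslash R^*(\mathbf q_i,p^2\mathbf q)$, and each $\Psi_A$ is divisible from the right by exactly $2$ such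 classes. -/

import Mathlib

/-! Integral quadratic forms, their automorphs, the norm form on the even Clifford subalgebra of a
ternary form, and the lift of ternary automorphs to quaternary ones. -/

namespace AutomorphLift

noncomputable section

/-- Integral quadratic forms `∑_{i ≤ j} q_ij x_i x_j`, `q_ij ∈ ℤ`, in `m` variables. -/
abbrev IntForm (m : ℕ) : Type := QuadraticForm ℤ (Fin m → ℤ)

/-- The (even) matrix `Q = (q_ij) + ᵗ(q_ij)` of a form `q`, so that `2 q(X) = ᵗX Q X`. -/
def formMatrix {m : ℕ} (q : IntForm m) : Matrix (Fin m) (Fin m) ℤ :=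
  Matrix.of fun i j => QuadraticMap.polar q (Pi.single i 1) (Pi.single j 1)

/-- The determinant of a form is the determinant of its matrix `Q`. -/
def formDet {m : ℕ} (q : IntForm m) : ℤ := (formMatrix q).det

/-- The form `q[A]`, `q[A](Y) = q(AY)`. -/
def subst {m n : ℕ} (q : IntForm m) (A : Matrix (Fin m) (Fin n) ℤ) : IntForm n :=
  q.comp (Matrix.toLin' A)

/-- The set `R(q, q')` of integral representations of `q'` by `q`. -/
def Rep {m n : ℕ} (q : IntForm m) (q' : IntForm n) : Set (Matrix (Fin m) (Fin n) ℤ) :=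
  {A | subst q A = q'}

/-- The set `R*(q, q')` of primitive representations: the entries are coprime. -/
def PrimRep {m n : ℕ} (q : IntForm m) (q' : IntForm n) : Set (Matrix (Fin m) (Fin n) ℤ) :=
  {A | A ∈ Rep q q' ∧ ∀ d : ℤ, (∀ i j, d ∣ A i j) → IsUnit d}

theorem subst_mul {m n k : ℕ} (q : IntForm m) (A : Matrix (Fin m) (Fin n) ℤ)
    (B : Matrix (Fin n) (Fin k) ℤ) : subst q (A * B) = subst (subst q A) B := by
  ext x
  simp [subst]

theorem subst_one {m : ℕ} (q : IntForm m) : subst q 1 = q := by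
  ext x
  simp [subst]

/-- The group of units `E(q) = R(q, q) ∩ GL_m(ℤ)`. -/
def unitGroup {m : ℕ} (q : IntForm m) : Subgroup (Matrix.GeneralLinearGroup (Fin m) ℤ) where
  carrier := {U | (U : Matrix (Fin m) (Fin m) ℤ) ∈ Rep q q}
  one_mem' := subst_one q
  mul_mem' := by
    intro U V hU hV
    simp only [Rep, Set.mem_ofPred_eq, Units.val_mul, subst_mul] at *
    rw [hU, hV]
  inv_mem' := by
    intro U hU
    simp only [Rep, Set.mem_ofPred_eq] at *
    nth_rewrite 1 [← hU]
    rw [← subst_mul, Units.mul_inv, subst_one]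

/-- Integral equivalence: `q' = q[U]` with `U ∈ GL_m(ℤ)`. -/
def Equivalent {m : ℕ} (q q' : IntForm m) : Prop :=
  ∃ U : Matrix.GeneralLinearGroup (Fin m) ℤ, subst q (U : Matrix (Fin m) (Fin m) ℤ) = q'

/-- `q'` is similar to `q`: equal determinants, and `R(q, a q')` is not empty for some (nonzero)
multiplier `a` prime to the determinant. -/
def Similar {m : ℕ} (q q' : IntForm m) : Prop :=
  formDet q = formDet q' ∧
    ∃ a : ℤ, a ≠ 0 ∧ IsCoprime a (formDet q) ∧ (Rep q (a • q')).Nonempty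

/-- `f` is a complete system of representatives of the different classes of integrally equivalent
forms in the similarity class of `q`. -/
structure IsCompleteSystem {m : ℕ} {ι : Type*} (q : IntForm m) (f : ι → IntForm m) : Prop where
  similar : ∀ i, Similar q (f i)
  inequivalent : ∀ i j, Equivalent (f i) (f j) → i = j
  complete : ∀ q' : IntForm m, Similar q q' → ∃ i, Equivalent (f i) q'

/-- Left equivalence modulo the group of units `E(q)` on a set `S` of matrices. -/
def leftSetoid {m n : ℕ} (q : IntForm m) (S : Set (Matrix (Fin m) (Fin n) ℤ)) : Setoid S where
  r A D := ∃ U ∈ unitGroup q,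
    (A : Matrix (Fin m) (Fin n) ℤ) = (U : Matrix (Fin m) (Fin m) ℤ) * (D : Matrix (Fin m) (Fin n) ℤ)
  iseqv :=
    { refl := fun A => ⟨1, one_mem _, by simp⟩
      symm := by
        rintro A D ⟨U, hU, h⟩
        exact ⟨U⁻¹, inv_mem hU, by rw [h, ← Matrix.mul_assoc, Units.inv_mul, Matrix.one_mul]⟩
      trans := by
        rintro A B D ⟨U, hU, h⟩ ⟨V, hV, h'⟩
        exact ⟨U * V, mul_mem hU hV, by rw [h, h', Units.val_mul, Matrix.mul_assoc]⟩ }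

/-- The set of left classes `E(q) \ S`. -/
abbrev LeftClasses {m n : ℕ} (q : IntForm m) (S : Set (Matrix (Fin m) (Fin n) ℤ)) : Type :=
  Quotient (leftSetoid q S)

/-! ### The even Clifford subalgebra of a ternary form and its natural basis -/

/-- The standard basis vectors of `E = ℤ³`, as elements of the Clifford algebra (indices `0, 1, 2`
stand for `1, 2, 3`). -/
def gen (q : IntForm 3) (i : Fin 3) : CliffordAlgebra q := CliffordAlgebra.ι q (Pi.single i 1)

/-- The products `e_i e_j` as elements of the even subalgebra. -/
def genMul (q : IntForm 3) (i j : Fin 3) : CliffordAlgebra.even q :=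
  (CliffordAlgebra.even.ι q).bilin (Pi.single i 1) (Pi.single j 1)

theorem coe_genMul (q : IntForm 3) (i j : Fin 3) :
    (genMul q i j : CliffordAlgebra q) = gen q i * gen q j := rfl

/-- The natural family `e_0 = 1, e_23, -e_13, e_12` of the even subalgebra. -/
def natFamily (q : IntForm 3) : Fin 4 → CliffordAlgebra.even q :=
  ![1, genMul q 1 2, -genMul q 0 2, genMul q 0 1]

theorem algebraMap_inj {m : ℕ} (q : IntForm m) :
    Function.Injective (algebraMap ℤ (CliffordAlgebra q)) := by
  obtain ⟨B, hB⟩ := LinearMap.BilinMap.toQuadraticMap_surjective (-q)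
  have h : B.toQuadraticMap = (0 : QuadraticForm ℤ (Fin m → ℤ)) - q := by rw [hB, zero_sub]
  intro a b hab
  have := congrArg (CliffordAlgebra.changeForm h) hab
  rw [CliffordAlgebra.changeForm_algebraMap, CliffordAlgebra.changeForm_algebraMap] at this
  exact (ExteriorAlgebra.algebraMap_leftInverse (Fin m → ℤ)).injective this

theorem gen_sq (q : IntForm 3) (i : Fin 3) :
    gen q i * gen q i = algebraMap ℤ _ (q (Pi.single i 1)) :=
  CliffordAlgebra.ι_sq_scalar q _

theorem gen_swap (q : IntForm 3) (i j : Fin 3) :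
    gen q j * gen q i = algebraMap ℤ _ (formMatrix q i j) - gen q i * gen q j := by
  rw [eq_sub_iff_add_eq, add_comm]
  exact CliffordAlgebra.ι_mul_ι_add_swap _ _

theorem natFamily_linearIndependent (q : IntForm 3) : LinearIndependent ℤ (natFamily q) := by
  let d : Fin 3 → Module.Dual ℤ (Fin 3 → ℤ) := fun i => LinearMap.proj i
  have hd : ∀ i j k l, CliffordAlgebra.contractLeft (d l)
      (CliffordAlgebra.contractLeft (d k) (gen q i * gen q j)) = algebraMap ℤ _
        (d k (Pi.single i 1) * d l (Pi.single j 1) - d l (Pi.single i 1) * d k (Pi.single j 1)) := by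
    intro i j k l
    simp only [gen, CliffordAlgebra.contractLeft_ι_mul, CliffordAlgebra.contractLeft_ι, map_sub,
      map_smul, CliffordAlgebra.contractLeft_mul_algebraMap]
    simp only [Algebra.smul_def, ← map_mul, ← map_sub]
  rw [Fintype.linearIndependent_iff]
  intro g hg
  have h := congrArg (CliffordAlgebra.even q).val hg
  simp only [Fin.sum_univ_four, natFamily, map_add, map_smul, map_neg, map_one, map_zero,
    Matrix.cons_val, Subalgebra.coe_val, coe_genMul] at h
  have key : ∀ k l, _ := fun k l => congrArg (fun x => CliffordAlgebra.contractLeft (d l)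
    (CliffordAlgebra.contractLeft (d k) x)) h
  simp only [map_add, map_smul, map_neg, hd, CliffordAlgebra.contractLeft_one, map_zero] at key
  simp only [Algebra.smul_def, ← map_mul, ← map_neg, ← map_add, mul_zero, zero_add] at key
  have h1 : g 1 = 0 := by
    have := algebraMap_inj q ((key 1 2).trans (map_zero _).symm)
    simpa [d] using this
  have h2 : g 2 = 0 := by
    have := algebraMap_inj q ((key 0 2).trans (map_zero _).symm)
    simpa [d] using this
  have h3 : g 3 = 0 := by
    have := algebraMap_inj q ((key 0 1).trans (map_zero _).symm)
    simpa [d] using this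
  have h0 : g 0 = 0 := by
    rw [h1, h2, h3, ← Algebra.algebraMap_eq_smul_one] at h
    exact algebraMap_inj q (by simpa using h)
  intro i
  fin_cases i <;> assumption

theorem gen_expand (q : IntForm 3) (v : Fin 3 → ℤ) :
    CliffordAlgebra.ι q v = ∑ i, v i • gen q i := by
  have : v = ∑ i, v i • (Pi.single i 1 : Fin 3 → ℤ) := by
    ext j
    simp [Finset.sum_apply, Pi.single_apply]
  conv_lhs => rw [this, map_sum]
  simp only [map_smul, gen]

theorem gen_mul_mem (q : IntForm 3) (i j : Fin 3) (x : CliffordAlgebra q)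
    (hx : x ∈ Submodule.span ℤ {1, gen q 0 * gen q 1, gen q 0 * gen q 2, gen q 1 * gen q 2}) :
    gen q i * (gen q j * x) ∈
      Submodule.span ℤ {1, gen q 0 * gen q 1, gen q 0 * gen q 2, gen q 1 * gen q 2} := by
  set S := Submodule.span ℤ {1, gen q 0 * gen q 1, gen q 0 * gen q 2, gen q 1 * gen q 2} with hS
  have m0 : (1 : CliffordAlgebra q) ∈ S := Submodule.subset_span (by simp)
  have m1 : gen q 0 * gen q 1 ∈ S := Submodule.subset_span (by simp)
  have m2 : gen q 0 * gen q 2 ∈ S := Submodule.subset_span (by simp)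
  have m3 : gen q 1 * gen q 2 ∈ S := Submodule.subset_span (by simp)
  have s : ∀ i, gen q i * gen q i = q (Pi.single i 1) • (1 : CliffordAlgebra q) := fun i => by
    rw [gen_sq, Algebra.algebraMap_eq_smul_one]
  have s' : ∀ i x, gen q i * (gen q i * x) = q (Pi.single i 1) • x := fun i x => by
    rw [← mul_assoc, s, smul_mul_assoc, one_mul]
  have w : ∀ i j, gen q j * gen q i = formMatrix q i j • (1 : CliffordAlgebra q)
      - gen q i * gen q j := fun i j => by
    rw [gen_swap, Algebra.algebraMap_eq_smul_one]
  have w' : ∀ i j x, gen q j * (gen q i * x) = formMatrix q i j • x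
      - gen q i * (gen q j * x) := fun i j x => by
    rw [← mul_assoc, w, sub_mul, smul_mul_assoc, one_mul, mul_assoc]
  induction hx using Submodule.span_induction with
  | zero => simp
  | add x y _ _ hx hy => simpa [mul_add] using S.add_mem hx hy
  | smul a x _ hx => simpa only [mul_smul_comm] using S.smul_mem a hx
  | mem x hx =>
    simp only [Set.mem_insert_iff, Set.mem_singleton_iff] at hx
    rcases hx with rfl | rfl | rfl | rfl <;> fin_cases i <;> fin_cases j <;>
    simp only [Fin.zero_eta, Fin.mk_one, Fin.reduceFinMk, mul_one, s, s', w 0 1, w 0 2, w 1 2,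
      w' 0 1, w' 0 2, w' 1 2, mul_sub, mul_smul_comm] <;>
    repeat' first | assumption | apply S.sub_mem | apply S.smul_mem

theorem natFamily_span (q : IntForm 3) : ⊤ ≤ Submodule.span ℤ (Set.range (natFamily q)) := by
  set S := Submodule.span ℤ {1, gen q 0 * gen q 1, gen q 0 * gen q 2, gen q 1 * gen q 2} with hS
  have hle : S ≤ (Submodule.span ℤ (Set.range (natFamily q))).map
      (CliffordAlgebra.even q).val.toLinearMap := by
    rw [hS, Submodule.span_le]
    have hm : ∀ k, natFamily q k ∈ Submodule.span ℤ (Set.range (natFamily q)) := fun k =>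
      Submodule.subset_span ⟨k, rfl⟩
    rintro x (rfl | rfl | rfl | rfl)
    · exact ⟨_, hm 0, rfl⟩
    · exact ⟨_, hm 3, rfl⟩
    · refine ⟨-natFamily q 2, Submodule.neg_mem _ (hm 2), ?_⟩
      simp [natFamily, coe_genMul]
    · exact ⟨_, hm 1, rfl⟩
  have hall : ∀ x ∈ CliffordAlgebra.evenOdd q 0, x ∈ S := by
    intro x hx
    induction x, hx using CliffordAlgebra.even_induction with
    | algebraMap r =>
      rw [Algebra.algebraMap_eq_smul_one]
      exact S.smul_mem _ (Submodule.subset_span (by simp))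
    | add x y hx hy h1 h2 => exact S.add_mem h1 h2
    | ι_mul_ι_mul v w x hx h =>
      rw [gen_expand q v, gen_expand q w]
      simp only [Finset.sum_mul, Finset.mul_sum, smul_mul_assoc, mul_smul_comm, mul_assoc]
      exact S.sum_mem fun i _ => S.smul_mem _ (S.sum_mem fun j _ => S.smul_mem _
        (gen_mul_mem q _ _ x h))
  rintro ⟨x, hx⟩ -
  obtain ⟨y, hy, hyx⟩ := hle (hall x hx)
  have : y = ⟨x, hx⟩ := Subtype.ext hyx
  exact this ▸ hy

/-- The natural basis `e_0 = 1, e_23, -e_13, e_12` of the even subalgebra `C_0(E)`. -/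
def natBasis (q : IntForm 3) : Module.Basis (Fin 4) ℤ (CliffordAlgebra.even q) :=
  Module.Basis.mk (natFamily_linearIndependent q) (natFamily_span q)

/-- The involution `x ↦ x̄` on the even subalgebra: the restriction of the antiautomorphism of the
Clifford algebra with `ē_j = -e_j` (Mathlib's `star`). -/
def conj (q : IntForm 3) : CliffordAlgebra.even q →ₗ[ℤ] CliffordAlgebra.even q where
  toFun x := ⟨star (x : CliffordAlgebra q), by
    have hx : (x : CliffordAlgebra q) ∈ CliffordAlgebra.evenOdd q 0 := x.2
    change star (x : CliffordAlgebra q) ∈ CliffordAlgebra.evenOdd q 0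
    rw [CliffordAlgebra.star_def, CliffordAlgebra.reverse_mem_evenOdd_iff,
      CliffordAlgebra.involute_mem_evenOdd_iff]
    exact hx⟩
  map_add' x y := Subtype.ext (star_add (x : CliffordAlgebra q) y)
  map_smul' a x := Subtype.ext (CliffordAlgebra.star_smul a (x : CliffordAlgebra q))

/-- The element of the even subalgebra with coordinates `x` in the natural basis. -/
def ofCoords (q : IntForm 3) : (Fin 4 → ℤ) →ₗ[ℤ] CliffordAlgebra.even q :=
  (natBasis q).equivFun.symm.toLinearMap

/-- The norm form: the quaternary form `n(x) = x x̄` on the even subalgebra, in coordinates with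
respect to the natural basis. The product `x x̄` is an integer multiple of `e_0 = 1` (see
`normForm_spec`), which is read off as its coordinate at `e_0`. -/
def normForm (q : IntForm 3) : IntForm 4 :=
  LinearMap.BilinMap.toQuadraticMap
    (((LinearMap.mul ℤ (CliffordAlgebra.even q)).compl₁₂ (ofCoords q)
      ((conj q).comp (ofCoords q))).compr₂ ((natBasis q).coord 0))

theorem coe_ofCoords (q : IntForm 3) (x : Fin 4 → ℤ) :
    (ofCoords q x : CliffordAlgebra q) = x 0 • (1 : CliffordAlgebra q) + x 1 • (gen q 1 * gen q 2)
      - x 2 • (gen q 0 * gen q 2) + x 3 • (gen q 0 * gen q 1) := by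
  have h := congrArg (CliffordAlgebra.even q).val ((natBasis q).equivFun_symm_apply x)
  simp only [natBasis, Module.Basis.coe_mk, Fin.sum_univ_four, natFamily, map_add, map_smul,
    map_neg, map_one, Matrix.cons_val, Subalgebra.coe_val, coe_genMul] at h
  rw [smul_neg, ← sub_eq_add_neg] at h
  exact h

theorem mul_conj_eq (q : IntForm 3) (x : Fin 4 → ℤ) :
    ofCoords q x * conj q (ofCoords q x) = algebraMap ℤ _
      (x 0 ^ 2 + x 0 * (formMatrix q 1 2 * x 1 - formMatrix q 0 2 * x 2 + formMatrix q 0 1 * x 3)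
        + q (Pi.single 1 1) * q (Pi.single 2 1) * x 1 ^ 2
        + q (Pi.single 0 1) * q (Pi.single 2 1) * x 2 ^ 2
        + q (Pi.single 0 1) * q (Pi.single 1 1) * x 3 ^ 2
        - q (Pi.single 2 1) * formMatrix q 0 1 * (x 1 * x 2)
        + (formMatrix q 0 1 * formMatrix q 1 2 - q (Pi.single 1 1) * formMatrix q 0 2)
          * (x 1 * x 3)
        - q (Pi.single 0 1) * formMatrix q 1 2 * (x 2 * x 3)) := by
  have s : ∀ i, gen q i * gen q i = q (Pi.single i 1) • (1 : CliffordAlgebra q) := fun i => by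
    rw [gen_sq, Algebra.algebraMap_eq_smul_one]
  have s' : ∀ i x, gen q i * (gen q i * x) = q (Pi.single i 1) • x := fun i x => by
    rw [← mul_assoc, s, smul_mul_assoc, one_mul]
  have w : ∀ i j, gen q j * gen q i = formMatrix q i j • (1 : CliffordAlgebra q)
      - gen q i * gen q j := fun i j => by
    rw [gen_swap, Algebra.algebraMap_eq_smul_one]
  have w' : ∀ i j x, gen q j * (gen q i * x) = formMatrix q i j • x
      - gen q i * (gen q j * x) := fun i j x => by
    rw [← mul_assoc, w, sub_mul, smul_mul_assoc, one_mul, mul_assoc]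
  have st : ∀ i, star (gen q i) = -gen q i := fun i => CliffordAlgebra.star_ι _
  apply Subtype.ext
  change (ofCoords q x : CliffordAlgebra q) * star (ofCoords q x : CliffordAlgebra q)
    = algebraMap ℤ (CliffordAlgebra q) _
  rw [coe_ofCoords, Algebra.algebraMap_eq_smul_one]
  simp only [star_add, star_sub, CliffordAlgebra.star_smul, star_one, star_mul, st, neg_mul_neg,
    add_mul, sub_mul, mul_add, mul_sub, smul_mul_assoc, mul_smul_comm, mul_assoc, one_mul, mul_one,
    s, s', w 0 1, w 0 2, w 1 2, w' 0 1, w' 0 2, w' 1 2, smul_sub]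
  match_scalars <;> ring

theorem normForm_spec (q : IntForm 3) (x : Fin 4 → ℤ) :
    ofCoords q x * conj q (ofCoords q x) = algebraMap ℤ _ (normForm q x) := by
  obtain ⟨r, hr⟩ : ∃ r : ℤ, ofCoords q x * conj q (ofCoords q x) = algebraMap ℤ _ r :=
    ⟨_, mul_conj_eq q x⟩
  have h : normForm q x = (natBasis q).coord 0 (ofCoords q x * conj q (ofCoords q x)) := rfl
  have h0 : natBasis q 0 = 1 := by simp [natBasis, natFamily]
  have hn : normForm q x = r := by
    rw [h, hr, Algebra.algebraMap_eq_smul_one, map_smul, ← h0, Module.Basis.coord_apply,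
      Module.Basis.repr_self, Finsupp.single_eq_same, smul_eq_mul, mul_one]
  rw [hr, hn]

/-! ### The lift of ternary automorphs -/

/-- The isometry `α_A : (E'', q'') → (E, q)` with matrix `A ∈ R(q, q'')`. -/
def isometryOf {q q'' : IntForm 3} {A : Matrix (Fin 3) (Fin 3) ℤ} (hA : A ∈ Rep q q'') :
    q'' →qᵢ q where
  toLinearMap := Matrix.toLin' A
  map_app' x := DFunLike.congr_fun (show subst q A = q'' from hA) x

/-- The restriction `C_0(E'') → C_0(E)` of the homomorphism `φ_A : C(E'') → C(E)` of Clifford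
algebras induced by the isometry `α_A`. -/
def evenMap {q q'' : IntForm 3} {A : Matrix (Fin 3) (Fin 3) ℤ} (hA : A ∈ Rep q q'') :
    CliffordAlgebra.even q'' →ₐ[ℤ] CliffordAlgebra.even q :=
  ((CliffordAlgebra.map (isometryOf hA)).comp (CliffordAlgebra.even q'').val).codRestrict
    (CliffordAlgebra.even q) fun x => by
      obtain ⟨x, hx⟩ := x
      change CliffordAlgebra.map (isometryOf hA) x ∈ CliffordAlgebra.even q
      change x ∈ CliffordAlgebra.evenOdd q'' 0 at hx
      induction x, hx using CliffordAlgebra.even_induction with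
      | algebraMap r =>
        rw [AlgHom.commutes]
        exact Subalgebra.algebraMap_mem _ r
      | add x y _ _ hx hy =>
        rw [map_add]
        exact add_mem hx hy
      | ι_mul_ι_mul v w x _ hx =>
        rw [map_mul, map_mul, CliffordAlgebra.map_apply_ι, CliffordAlgebra.map_apply_ι]
        exact mul_mem (CliffordAlgebra.ι_mul_ι_mem_evenOdd_zero q _ _) hx

/-- The matrix `Φ_A` of the homomorphism `C_0(E'') → C_0(E)` with respect to the natural bases. -/
def liftPhi {q q'' : IntForm 3} {A : Matrix (Fin 3) (Fin 3) ℤ} (hA : A ∈ Rep q q'') :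
    Matrix (Fin 4) (Fin 4) ℤ :=
  LinearMap.toMatrix (natBasis q'') (natBasis q) (evenMap hA).toLinearMap

/-- The lift `Ψ_A = Φ_A · diag(p, p⁻¹, p⁻¹, p⁻¹)` of an automorph `A ∈ R(q, p² q')`, where
`A` is regarded as an element of `R(q, q'')` with `q'' = p² q'`. -/
def liftPsi (p : ℕ) {q q' : IntForm 3} {A : Matrix (Fin 3) (Fin 3) ℤ}
    (hA : A ∈ Rep q ((p : ℤ) ^ 2 • q')) : Matrix (Fin 4) (Fin 4) ℚ :=
  (liftPhi hA).map (Int.cast : ℤ → ℚ) *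
    Matrix.diagonal ![(p : ℚ), (p : ℚ)⁻¹, (p : ℚ)⁻¹, (p : ℚ)⁻¹]

/-- `M` divides `P` from the right: `P M⁻¹` is an integral matrix. -/
def RightDivides (M : Matrix (Fin 4) (Fin 4) ℤ) (P : Matrix (Fin 4) (Fin 4) ℚ) : Prop :=
  ∃ X : Matrix (Fin 4) (Fin 4) ℤ,
    P * (M.map (Int.cast : ℤ → ℚ))⁻¹ = X.map (Int.cast : ℤ → ℚ)

/-- The (disjoint) union over `i` of the sets `E(q_i) \ R*(q_i, p² q)` of classes of ternary
primitive automorphs with multiplier `p²`. -/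
abbrev TernaryClasses {h : ℕ} (q : IntForm 3) (f : Fin h → IntForm 3) (p : ℕ) : Type :=
  Σ i, LeftClasses (f i) (PrimRep (f i) ((p : ℤ) ^ 2 • q))

/-- The (disjoint) union over `j` of the sets `E(n_j) \ R(n_j, p n)` of classes of quaternary
automorphs with multiplier `p`. -/
abbrev QuaternaryClasses {H : ℕ} (n : IntForm 4) (g : Fin H → IntForm 4) (p : ℕ) : Type :=
  Σ j, LeftClasses (g j) (Rep (g j) ((p : ℤ) • n))

/-- The quaternary class `μ` divides `Ψ_A` from the right for `A` in the ternary class `α`: this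
holds for some representatives (for all of them, in fact, when the multiplier is a good prime). -/
def ClassDivides {h H : ℕ} {q : IntForm 3} {n : IntForm 4} {f : Fin h → IntForm 3}
    {g : Fin H → IntForm 4} {p : ℕ} (μ : QuaternaryClasses n g p) (α : TernaryClasses q f p) :
    Prop :=
  ∃ (A : PrimRep (f α.1) ((p : ℤ) ^ 2 • q)) (M : Rep (g μ.1) ((p : ℤ) • n)),
    Quotient.mk _ A = α.2 ∧ Quotient.mk _ M = μ.2 ∧
      RightDivides (M : Matrix (Fin 4) (Fin 4) ℤ) (liftPsi p A.2.1)

end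

end AutomorphLift

namespace AutomorphLift
open Matrix

/-! ### Forms and their matrices -/

/-! Everything is read off from kernels modulo `p`. Left multiplication by a unimodular matrix keeps
the kernel, and for the matrices in question the kernel determines the left class, so both sets of
classes embed into sets of subspaces over `𝔽_p` (`ternaryKernel_injective`,
`quaternaryKernel_injective`). Let `Q` be the matrix of `q` modulo `p`; it is nondegenerate, and `p`
is odd because `det q` is even.

The images are as large as they can be. A primitive ternary automorph has rank one modulo `p` and
its kernel is a tangent plane `v^⊥` of the conic `Q = 0`; every tangent plane occurs, through the
neighbour of `ℤ³` at a lift of `v` (`range_ternaryKernel`). A quaternary automorph has as kernel a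
totally singular plane of the norm form, and every such plane occurs (`range_quaternaryKernel`). In
the coordinates of `coordMap`, four times the norm form is `z² + det Q · Q[y]`.

The lift of `A` is integral, and its kernel modulo `p` is the set of points with `y` in the kernel
of `A`. Since `p M⁻¹` is integral, right divisibility by `M` is inclusion of kernels, so `M` divides
the lift exactly when the plane of `M` projects into the tangent plane of `A`
(`rightDivides_liftPsi_iff`).

An incidence count over `𝔽_p` remains. A totally singular plane contains some `(0, v) ≠ 0`; then `v`
is isotropic and `v^⊥` is the only tangent plane containing the projection
(`IsSingularPlane.existsUnique_tangent`). Over a given `v^⊥` the form becomes `z² - k² b²` with `k ≠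
0`, whose zeros form the two planes `z = ± k b` (`IsTangent.ncard_singularPlanes`). -/

theorem polar_eq_dotProduct {m : ℕ} (q : IntForm m) (x y : Fin m → ℤ) :
    QuadraticMap.polar q x y = x ⬝ᵥ formMatrix q *ᵥ y := by
  have h : LinearMap.toMatrix₂' ℤ (QuadraticMap.polarBilin q) = formMatrix q := by
    ext i j
    simp [LinearMap.toMatrix₂'_apply, formMatrix]
  have h2 := congrArg (fun B => B x y) (Matrix.toLinearMap₂'_toMatrix' (R := ℤ) (QuadraticMap.polarBilin q))
  simp only [h, Matrix.toLinearMap₂'_apply'] at h2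
  rw [h2, QuadraticMap.polarBilin_apply_apply]

theorem two_mul_apply {m : ℕ} (q : IntForm m) (x : Fin m → ℤ) :
    2 * q x = x ⬝ᵥ formMatrix q *ᵥ x := by
  rw [← polar_eq_dotProduct, QuadraticMap.polar_self]; simp

theorem formMatrix_transpose {m : ℕ} (q : IntForm m) : (formMatrix q)ᵀ = formMatrix q := by
  ext i j
  simp [formMatrix, QuadraticMap.polar_comm]

theorem formMatrix_diag {m : ℕ} (q : IntForm m) (i : Fin m) :
    formMatrix q i i = 2 * q (Pi.single i 1) := by
  simp [formMatrix, QuadraticMap.polar_self]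

theorem subst_apply {m n : ℕ} (q : IntForm m) (A : Matrix (Fin m) (Fin n) ℤ) (x : Fin n → ℤ) :
    subst q A x = q (A *ᵥ x) := rfl

theorem matrix_ext_of_dotProduct {R : Type*} [CommRing R] {m n : ℕ} {A B : Matrix (Fin m) (Fin n) R}
    (h : ∀ x y, x ⬝ᵥ A *ᵥ y = x ⬝ᵥ B *ᵥ y) : A = B := by
  ext i j
  simpa using h (Pi.single i 1) (Pi.single j 1)

theorem formMatrix_subst {m n : ℕ} (q : IntForm m) (A : Matrix (Fin m) (Fin n) ℤ) :
    formMatrix (subst q A) = Aᵀ * formMatrix q * A := by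
  apply matrix_ext_of_dotProduct
  intro x y
  rw [← polar_eq_dotProduct]
  simp only [QuadraticMap.polar, subst_apply, mulVec_add]
  rw [← QuadraticMap.polar, polar_eq_dotProduct]
  simp only [← mulVec_mulVec]
  rw [dotProduct_mulVec x, vecMul_transpose]

theorem formMatrix_smul {m : ℕ} (c : ℤ) (q : IntForm m) :
    formMatrix (c • q) = c • formMatrix q := by
  ext i j
  simp [formMatrix, QuadraticMap.polar, mul_sub]

theorem form_ext_of_smul {m : ℕ} {c : ℤ} (hc : c ≠ 0) {q q' : IntForm m} (h : c • q = c • q') :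
    q = q' := by
  ext x
  have := DFunLike.congr_fun h x
  simpa [hc] using this

/-- Divisibility is asked of the values, not of the entries of the matrix: polar values are
differences of values, so they are divisible too and the quotient is again an integral form. -/
theorem exists_form_of_dvd {m : ℕ} {c : ℤ} (hc : c ≠ 0) (q : IntForm m) (h : ∀ x, c ∣ q x) :
    ∃ q' : IntForm m, q = c • q' := by
  have hp : ∀ x y, c ∣ QuadraticMap.polar q x y := fun x y =>
    dvd_sub (dvd_sub (h _) (h _)) (h _)
  have e1 : ∀ x, c * (q x / c) = q x := fun x => Int.mul_ediv_cancel' (h x)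
  have e2 : ∀ x y, c * (QuadraticMap.polar q x y / c) = QuadraticMap.polar q x y :=
    fun x y => Int.mul_ediv_cancel' (hp x y)
  -- The integer divisions are exact by `e1` and `e2`, so each axiom is checked after multiplication
  -- by `c`.
  refine ⟨{ toFun := fun x => q x / c
            toFun_smul := ?_
            exists_companion' := ⟨LinearMap.mk₂ ℤ (fun x y => QuadraticMap.polar q x y / c)
              ?_ ?_ ?_ ?_, ?_⟩ }, ?_⟩
  · intro a x
    apply mul_left_cancel₀ hc
    rw [e1, q.map_smul, smul_eq_mul, smul_eq_mul, mul_left_comm, e1]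
  · intro x x' y
    apply mul_left_cancel₀ hc
    rw [mul_add, e2, e2, e2, QuadraticMap.polar_add_left]
  · intro a x y
    apply mul_left_cancel₀ hc
    rw [e2, QuadraticMap.polar_smul_left, smul_eq_mul, smul_eq_mul, mul_left_comm, e2]
  · intro x y y'
    apply mul_left_cancel₀ hc
    rw [mul_add, e2, e2, e2, QuadraticMap.polar_add_right]
  · intro a x y
    apply mul_left_cancel₀ hc
    rw [e2, QuadraticMap.polar_smul_right, smul_eq_mul, smul_eq_mul, mul_left_comm, e2]
  · intro x y
    apply mul_left_cancel₀ hc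
    simp only [LinearMap.mk₂_apply]
    rw [mul_add, mul_add, e1, e1, e1, e2, QuadraticMap.polar]
    ring
  · ext x
    exact (e1 x).symm

/-! ### Left classes and complete systems -/

/-- Mutual left factors cancel: `A = Y X A` with `A` nonsingular forces `Y X = 1`. -/
theorem exists_unit_of_left_factors {m : ℕ} {A A' X Y : Matrix (Fin m) (Fin m) ℤ}
    (hA : A.det ≠ 0) (h : A' = X * A) (h' : A = Y * A') :
    ∃ U : Matrix.GeneralLinearGroup (Fin m) ℤ, A' = (U : Matrix (Fin m) (Fin m) ℤ) * A := by
  have hYX : Y * X = 1 := by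
    have h1 : (Y * X - 1) * A = 0 := by
      rw [Matrix.sub_mul, Matrix.mul_assoc, ← h, ← h', Matrix.one_mul, sub_self]
    have h2 := congrArg (· * A.adjugate) h1
    simp only [Matrix.mul_assoc, mul_adjugate, Matrix.mul_smul, Matrix.mul_one, Matrix.zero_mul] at h2
    exact sub_eq_zero.mp ((smul_eq_zero.mp h2).resolve_left hA)
  exact ⟨⟨X, Y, mul_eq_one_comm.mp hYX, hYX⟩, h⟩

/-- A further substitution by the adjugate turns `A` into the scalar `det A`, which merely
multiplies a form by a nonzero square. -/
theorem subst_left_cancel {m : ℕ} {A : Matrix (Fin m) (Fin m) ℤ} (hA : A.det ≠ 0)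
    {q q' : IntForm m} (h : subst q A = subst q' A) : q = q' := by
  have h2 : subst q (A.det • (1 : Matrix (Fin m) (Fin m) ℤ)) = subst q' (A.det • 1) := by
    rw [← mul_adjugate, subst_mul, subst_mul, h]
  ext x
  have h3 := DFunLike.congr_fun h2 x
  simp only [subst_apply, smul_mulVec, one_mulVec, QuadraticMap.map_smul, smul_eq_mul] at h3
  exact mul_left_cancel₀ (mul_ne_zero hA hA) h3

/-- Two representations of the same form by members of a complete system which differ by a
unimodular factor belong to the same class. -/
theorem exists_unitGroup_of_complete {m : ℕ} {ι : Type*} {q r : IntForm m} {f : ι → IntForm m}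
    (hf : IsCompleteSystem q f) {i i' : ι} {A A' : Matrix (Fin m) (Fin m) ℤ}
    (hA : A ∈ Rep (f i) r) (hA' : A' ∈ Rep (f i') r) (h0 : A.det ≠ 0)
    (U : Matrix.GeneralLinearGroup (Fin m) ℤ) (hU : A' = (U : Matrix (Fin m) (Fin m) ℤ) * A) :
    i = i' ∧ U ∈ unitGroup (f i) := by
  have h : subst (f i') (U : Matrix (Fin m) (Fin m) ℤ) = f i := by
    apply subst_left_cancel h0
    rw [← subst_mul, ← hU]
    exact Eq.trans hA' (Eq.symm hA)
  have hi := hf.inequivalent _ _ ⟨U, h⟩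
  subst hi
  exact ⟨rfl, h⟩

theorem eq_inv_mul_unit_mul {m : ℕ} (U : Matrix.GeneralLinearGroup (Fin m) ℤ)
    (A : Matrix (Fin m) (Fin m) ℤ) :
    A = ((U⁻¹ : Matrix.GeneralLinearGroup (Fin m) ℤ) : Matrix (Fin m) (Fin m) ℤ) *
      ((U : Matrix (Fin m) (Fin m) ℤ) * A) := by
  rw [← Matrix.mul_assoc, Units.inv_mul, Matrix.one_mul]

/-! ### Reduction modulo a prime -/

section Mod

variable (p : ℕ)

/-- Reduction of an integral matrix modulo `p`. -/
def redMat {m n : ℕ} (A : Matrix (Fin m) (Fin n) ℤ) : Matrix (Fin m) (Fin n) (ZMod p) :=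
  A.map (Int.castRingHom (ZMod p))

/-- Reduction of an integral vector modulo `p`. -/
def redVec {n : ℕ} (x : Fin n → ℤ) : Fin n → ZMod p := fun i => (x i : ZMod p)

theorem redMat_mul {m n k : ℕ} (A : Matrix (Fin m) (Fin n) ℤ) (B : Matrix (Fin n) (Fin k) ℤ) :
    redMat p (A * B) = redMat p A * redMat p B := Matrix.map_mul

theorem redMat_transpose {m n : ℕ} (A : Matrix (Fin m) (Fin n) ℤ) :
    redMat p Aᵀ = (redMat p A)ᵀ := rfl

theorem redMat_one {m : ℕ} : redMat p (1 : Matrix (Fin m) (Fin m) ℤ) = 1 := by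
  simp [redMat]

theorem redMat_smul {m n : ℕ} (c : ℤ) (A : Matrix (Fin m) (Fin n) ℤ) :
    redMat p (c • A) = (c : ZMod p) • redMat p A := by
  ext i j; simp [redMat]

theorem redMat_prime_smul {m n : ℕ} (A : Matrix (Fin m) (Fin n) ℤ) :
    redMat p ((p : ℤ) • A) = 0 := by
  rw [redMat_smul]; simp

theorem redMat_adjugate {m : ℕ} (A : Matrix (Fin m) (Fin m) ℤ) :
    redMat p A.adjugate = (redMat p A).adjugate := (Int.castRingHom (ZMod p)).map_adjugate A

theorem redMat_det {m : ℕ} (A : Matrix (Fin m) (Fin m) ℤ) :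
    (redMat p A).det = (A.det : ZMod p) := ((Int.castRingHom (ZMod p)).map_det A).symm

theorem redVec_mulVec {m n : ℕ} (A : Matrix (Fin m) (Fin n) ℤ) (x : Fin n → ℤ) :
    redVec p (A *ᵥ x) = redMat p A *ᵥ redVec p x := by
  ext i; simp [redVec, redMat, mulVec, dotProduct]

theorem redVec_dotProduct {n : ℕ} (x y : Fin n → ℤ) :
    redVec p x ⬝ᵥ redVec p y = ((x ⬝ᵥ y : ℤ) : ZMod p) := by
  simp [redVec, dotProduct]

theorem redVec_eq_zero {n : ℕ} (x : Fin n → ℤ) : redVec p x = 0 ↔ ∃ y, x = (p : ℤ) • y := by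
  constructor
  · intro h
    have h1 : ∀ i, (p : ℤ) ∣ x i := fun i =>
      (ZMod.intCast_zmod_eq_zero_iff_dvd _ _).mp (congrFun h i)
    choose y hy using h1
    exact ⟨y, funext fun i => by simpa using hy i⟩
  · rintro ⟨y, rfl⟩
    ext i; simp [redVec]

theorem redVec_surjective {n : ℕ} : Function.Surjective (redVec p (n := n)) := fun x =>
  ⟨fun i => (ZMod.intCast_surjective (x i)).choose,
    funext fun i => (ZMod.intCast_surjective (x i)).choose_spec⟩

theorem redMat_eq_zero {m n : ℕ} (A : Matrix (Fin m) (Fin n) ℤ) :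
    redMat p A = 0 ↔ ∃ B, A = (p : ℤ) • B := by
  constructor
  · intro h
    have h1 : ∀ i j, (p : ℤ) ∣ A i j := fun i j =>
      (ZMod.intCast_zmod_eq_zero_iff_dvd _ _).mp (congrFun (congrFun h i) j)
    choose B hB using h1
    exact ⟨B, Matrix.ext hB⟩
  · rintro ⟨B, rfl⟩
    exact redMat_prime_smul p B

/-- The kernel of an integral matrix modulo `p`. -/
def kerMod {m n : ℕ} (A : Matrix (Fin m) (Fin n) ℤ) : Submodule (ZMod p) (Fin n → ZMod p) :=
  LinearMap.ker (redMat p A).mulVecLin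

theorem mem_kerMod {m n : ℕ} {A : Matrix (Fin m) (Fin n) ℤ} {x : Fin n → ZMod p} :
    x ∈ kerMod p A ↔ redMat p A *ᵥ x = 0 := by simp [kerMod]

theorem redVec_mem_kerMod {m n : ℕ} {A : Matrix (Fin m) (Fin n) ℤ} {x : Fin n → ℤ} :
    redVec p x ∈ kerMod p A ↔ ∃ y, A *ᵥ x = (p : ℤ) • y := by
  rw [mem_kerMod, ← redVec_mulVec, redVec_eq_zero]

theorem kerMod_le_of_mul {m n k : ℕ} (X : Matrix (Fin k) (Fin m) ℤ) (A : Matrix (Fin m) (Fin n) ℤ) :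
    kerMod p A ≤ kerMod p (X * A) := by
  intro x hx
  rw [mem_kerMod] at *
  rw [redMat_mul, ← mulVec_mulVec, hx, mulVec_zero]

/-- This makes the kernel modulo `p` an invariant of left classes. -/
theorem kerMod_unit_mul {m : ℕ} (U : Matrix.GeneralLinearGroup (Fin m) ℤ)
    (A : Matrix (Fin m) (Fin m) ℤ) :
    kerMod p ((U : Matrix (Fin m) (Fin m) ℤ) * A) = kerMod p A := by
  apply le_antisymm _ (kerMod_le_of_mul p _ _)
  conv_rhs => rw [eq_inv_mul_unit_mul U A]
  exact kerMod_le_of_mul p _ _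

/-- If `B` maps into the kernel of `A` modulo `p`, then `A B ≡ 0`. -/
theorem exists_mul_eq_smul {m n k : ℕ} {A : Matrix (Fin m) (Fin n) ℤ} {B : Matrix (Fin n) (Fin k) ℤ}
    (h : ∀ x, redVec p (B *ᵥ x) ∈ kerMod p A) : ∃ X, A * B = (p : ℤ) • X := by
  rw [← redMat_eq_zero]
  ext i j
  have h1 := h (Pi.single j 1)
  rw [mem_kerMod, redVec_mulVec, mulVec_mulVec, ← redMat_mul] at h1
  have h2 : redVec p (Pi.single j (1 : ℤ) : Fin k → ℤ) = Pi.single j 1 := by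
    ext l; by_cases hl : l = j <;> simp [redVec, hl]
  rw [h2] at h1
  simpa using congrFun h1 i

end Mod

/-! ### Totally singular planes and tangent planes of a conic -/

section Planes

variable {F : Type*} [Field F]

/-- The quaternary form `z² + det Q · Q[y]` on `F × F³`. -/
def extForm (Q : Matrix (Fin 3) (Fin 3) F) (x : F × (Fin 3 → F)) : F :=
  x.1 ^ 2 + Q.det * (x.2 ⬝ᵥ Q *ᵥ x.2)

/-- The orthogonal complement of the vector `v`. -/
def tangentPlane (Q : Matrix (Fin 3) (Fin 3) F) (v : Fin 3 → F) : Submodule F (Fin 3 → F) :=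
  LinearMap.ker (Matrix.toLinearMap₂' F Q v)

theorem mem_tangentPlane {Q : Matrix (Fin 3) (Fin 3) F} {v y : Fin 3 → F} :
    y ∈ tangentPlane Q v ↔ v ⬝ᵥ Q *ᵥ y = 0 := by
  simp [tangentPlane, Matrix.toLinearMap₂'_apply']

/-- Tangent planes of the conic `Q = 0`. -/
def IsTangent (Q : Matrix (Fin 3) (Fin 3) F) (K : Submodule F (Fin 3 → F)) : Prop :=
  ∃ v, v ≠ 0 ∧ v ⬝ᵥ Q *ᵥ v = 0 ∧ K = tangentPlane Q v

/-- Totally singular planes of `z² + det Q · Q[y]`. -/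
def IsSingularPlane (Q : Matrix (Fin 3) (Fin 3) F) (W : Submodule F (F × (Fin 3 → F))) : Prop :=
  Module.finrank F W = 2 ∧ ∀ x ∈ W, extForm Q x = 0

/-- Source of the discriminant relations below: when one of the three vectors is isotropic and
orthogonal to another, the left side collapses to at most one term. -/
theorem det_gram (Q : Matrix (Fin 3) (Fin 3) F) (T : Fin 3 → Fin 3 → F) :
    (Matrix.of fun i j => T i ⬝ᵥ Q *ᵥ T j).det = Q.det * (Matrix.of T).det ^ 2 := by
  have h : (Matrix.of fun i j => T i ⬝ᵥ Q *ᵥ T j) = Matrix.of T * Q * (Matrix.of T)ᵀ := by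
    ext i j
    rw [Matrix.mul_assoc, Matrix.mul_apply']
    congr 1
  rw [h, det_mul, det_mul, det_transpose]
  ring

theorem dotProduct_mulVec_symm {n : ℕ} {R : Type*} [CommRing R] {Q : Matrix (Fin n) (Fin n) R}
    (hs : Qᵀ = Q) (x y : Fin n → R) :
    x ⬝ᵥ Q *ᵥ y = y ⬝ᵥ Q *ᵥ x := by
  rw [dotProduct_mulVec, ← mulVec_transpose, hs, dotProduct_comm]

variable {Q : Matrix (Fin 3) (Fin 3) F}

/-- A nondegenerate ternary form has no totally isotropic plane. The Gram determinant of `v, w, a`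
is zero for every `a`, hence so is `det (v, w, a)`, and the cross product of `v` and `w` vanishes.
-/
theorem parallel_of_isotropic (hs : Qᵀ = Q) (hd : Q.det ≠ 0) {v w : Fin 3 → F} (hv : v ≠ 0)
    (hvv : v ⬝ᵥ Q *ᵥ v = 0) (hww : w ⬝ᵥ Q *ᵥ w = 0) (hvw : v ⬝ᵥ Q *ᵥ w = 0) :
    ∃ c : F, w = c • v := by
  have hdet : ∀ a, a ⬝ᵥ crossProduct v w = 0 := by
    intro a
    have h := det_gram Q ![v, w, a]
    have hwv : w ⬝ᵥ Q *ᵥ v = 0 := by rw [dotProduct_mulVec_symm hs, hvw]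
    rw [det_fin_three] at h
    simp only [of_apply, cons_val, hvv, hww, hvw, hwv] at h
    have h0 : (Matrix.of ![v, w, a]).det = 0 := by
      have h1 : Q.det * (Matrix.of ![v, w, a]).det ^ 2 = 0 := by rw [← h]; ring
      simpa [hd] using h1
    rw [triple_product_permutation]
    exact (triple_product_eq_det v w a).trans h0
  have hc : crossProduct v w = 0 := by
    ext i
    simpa using hdet (Pi.single i 1)
  have hl : ¬ LinearIndependent F ![v, w] := fun h =>
    crossProduct_ne_zero_iff_linearIndependent.mpr h hc
  rw [LinearIndependent.pair_iff' hv] at hl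
  push Not at hl
  obtain ⟨c, hc⟩ := hl
  exact ⟨c, hc.symm⟩

theorem exists_dotProduct_ne_zero (hs : Qᵀ = Q) (hd : Q.det ≠ 0) {v : Fin 3 → F} (hv : v ≠ 0) :
    ∃ y, v ⬝ᵥ Q *ᵥ y ≠ 0 := by
  by_contra! h
  have h1 : Q *ᵥ v = 0 := by
    ext i
    have := h (Pi.single i 1)
    rw [dotProduct_mulVec_symm hs] at this
    simpa using this
  have h2 := Matrix.eq_zero_of_mulVec_eq_zero hd h1
  exact hv h2

theorem finrank_tangentPlane (hs : Qᵀ = Q) (hd : Q.det ≠ 0) {v : Fin 3 → F} (hv : v ≠ 0) :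
    Module.finrank F (tangentPlane Q v) = 2 := by
  let φ : (Fin 3 → F) →ₗ[F] F := Matrix.toLinearMap₂' F Q v
  have h := LinearMap.finrank_range_add_finrank_ker φ
  have h1 : LinearMap.range φ = ⊤ := by
    apply LinearMap.range_eq_top.mpr
    apply LinearMap.surjective
    obtain ⟨y, hy⟩ := exists_dotProduct_ne_zero hs hd hv
    intro h0
    apply hy
    have h3 : φ y = v ⬝ᵥ Q *ᵥ y := Matrix.toLinearMap₂'_apply' Q v y
    rw [← h3, h0, LinearMap.zero_apply]
  rw [h1, finrank_top, Module.finrank_self, Module.finrank_fin_fun] at h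
  change Module.finrank F (LinearMap.ker φ) = 2
  omega

/-- A tangent plane is spanned by the point of contact `v` and a vector `e` such that
`-det Q · Q[e]` is a nonzero square. -/
theorem exists_frame (hs : Qᵀ = Q) (hd : Q.det ≠ 0) {v : Fin 3 → F} (hv : v ≠ 0)
    (hvv : v ⬝ᵥ Q *ᵥ v = 0) :
    ∃ (e : Fin 3 → F) (k : F), k ≠ 0 ∧ v ⬝ᵥ Q *ᵥ e = 0 ∧ Q.det * (e ⬝ᵥ Q *ᵥ e) = -k ^ 2 ∧
      (∀ a : F, a • v ≠ e) ∧ ∀ y, v ⬝ᵥ Q *ᵥ y = 0 → ∃ α β : F, α • v + β • e = y := by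
  have hf := finrank_tangentPlane hs hd hv
  obtain ⟨e, he, hev⟩ : ∃ e ∈ tangentPlane Q v, e ∉ Submodule.span F {v} := by
    by_contra! h
    have h1 := Submodule.finrank_mono h
    rw [hf, finrank_span_singleton hv] at h1
    omega
  rw [mem_tangentPlane] at he
  have hev' : ∀ a : F, a • v ≠ e := fun a ha => hev (Submodule.mem_span_singleton.mpr ⟨a, ha⟩)
  obtain ⟨u, hu⟩ := exists_dotProduct_ne_zero hs hd hv
  -- An isotropic `e` orthogonal to `v` would be a multiple of `v`.
  have hc : e ⬝ᵥ Q *ᵥ e ≠ 0 := by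
    intro h
    obtain ⟨c, hc⟩ := parallel_of_isotropic hs hd hv hvv h he
    exact hev' c hc.symm
  -- The Gram determinant of `v, e, u` is `-⟨v, u⟩² Q[e]`; comparing it with `det Q` times a square
  -- gives the value of `k`.
  have hk : Q.det * (e ⬝ᵥ Q *ᵥ e) =
      -(Q.det * (Matrix.of ![v, e, u]).det / (v ⬝ᵥ Q *ᵥ u)) ^ 2 := by
    have h := det_gram Q ![v, e, u]
    rw [det_fin_three] at h
    simp only [of_apply, cons_val] at h
    rw [dotProduct_mulVec_symm hs e v, dotProduct_mulVec_symm hs u v, he, hvv] at h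
    field_simp
    linear_combination -h
  refine ⟨e, _, ?_, he, hk, hev', ?_⟩
  · intro h0
    rw [h0] at hk
    simp [hd, hc] at hk
  · intro y hy
    have hli : LinearIndependent F ![v, e] := (LinearIndependent.pair_iff' hv).mpr hev'
    have hle : Submodule.span F {v, e} ≤ tangentPlane Q v := by
      rw [Submodule.span_le]
      rintro x (rfl | rfl)
      · exact mem_tangentPlane.mpr hvv
      · exact mem_tangentPlane.mpr he
    have heq : Submodule.span F {v, e} = tangentPlane Q v := by
      apply Submodule.eq_of_le_of_finrank_eq hle
      have := finrank_span_eq_card hli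
      rw [Matrix.range_cons_cons_empty] at this
      rw [hf, this]; simp
    have hy' : y ∈ Submodule.span F {v, e} := heq ▸ mem_tangentPlane.mpr hy
    exact Submodule.mem_span_pair.mp hy'

theorem extForm_add (hs : Qᵀ = Q) (x y : F × (Fin 3 → F)) :
    extForm Q (x + y) =
      extForm Q x + extForm Q y + 2 * (x.1 * y.1 + Q.det * (x.2 ⬝ᵥ Q *ᵥ y.2)) := by
  simp only [extForm, Prod.fst_add, Prod.snd_add, mulVec_add, add_dotProduct, dotProduct_add]
  rw [dotProduct_mulVec_symm hs y.2 x.2]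
  ring

/-- A plane meets the hyperplane `z = 0` in some `(0, v) ≠ 0`, and `v` is isotropic. The polar form
vanishes on `W`, so `W` projects into `v^⊥`. If it also projects into `w^⊥`, then `v` lies in `w^⊥`,
and two orthogonal isotropic vectors are parallel. -/
theorem IsSingularPlane.existsUnique_tangent (h2 : (2 : F) ≠ 0) (hs : Qᵀ = Q) (hd : Q.det ≠ 0)
    {W : Submodule F (F × (Fin 3 → F))} (hW : IsSingularPlane Q W) :
    ∃! K, IsTangent Q K ∧ ∀ x ∈ W, x.2 ∈ K := by
  obtain ⟨hr, hW⟩ := hW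
  obtain ⟨x, hx, hx0, hx1⟩ : ∃ x ∈ W, x ≠ 0 ∧ x.1 = 0 := by
    have hlt : Module.finrank F F < Module.finrank F W := by rw [hr, Module.finrank_self]; omega
    have hker := LinearMap.ker_ne_bot_of_finrank_lt
      (f := (LinearMap.fst F F (Fin 3 → F)).domRestrict W) hlt
    obtain ⟨y, hy, hy0⟩ := Submodule.exists_mem_ne_zero_of_ne_bot hker
    exact ⟨y, y.2, fun h => hy0 (Subtype.ext h), by simpa using hy⟩
  have hv : x.2 ≠ 0 := fun h => hx0 (Prod.ext hx1 h)
  have hvv : x.2 ⬝ᵥ Q *ᵥ x.2 = 0 := by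
    have := hW x hx
    simpa [extForm, hx1, hd] using this
  have hvy : ∀ y ∈ W, y.2 ∈ tangentPlane Q x.2 := by
    intro y hy
    rw [mem_tangentPlane]
    have h := extForm_add hs x y
    rw [hW _ (W.add_mem hx hy), hW _ hx, hW _ hy, hx1] at h
    simpa [h2, hd] using h.symm
  refine ⟨tangentPlane Q x.2, ⟨⟨x.2, hv, hvv, rfl⟩, hvy⟩, ?_⟩
  rintro K ⟨⟨w, hw, hww, rfl⟩, hKW⟩
  have hwx : w ⬝ᵥ Q *ᵥ x.2 = 0 := mem_tangentPlane.mp (hKW x hx)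
  obtain ⟨c, hc⟩ := parallel_of_isotropic hs hd hw hww hvv hwx
  have hc0 : c ≠ 0 := by
    rintro rfl
    exact hv (by rw [hc, zero_smul])
  ext y
  rw [mem_tangentPlane, mem_tangentPlane, hc, smul_dotProduct, smul_eq_zero]
  simp [hc0]

/-- On points `(z, a v + b e)` over the tangent plane the form is `z² - k² b² = (z - k b)(z + k b)`,
and each factor cuts out one singular plane. -/
theorem IsTangent.ncard_singularPlanes (h2 : (2 : F) ≠ 0) (hs : Qᵀ = Q) (hd : Q.det ≠ 0)
    {K : Submodule F (Fin 3 → F)} (hK : IsTangent Q K) :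
    {W : Submodule F (F × (Fin 3 → F)) | IsSingularPlane Q W ∧ ∀ x ∈ W, x.2 ∈ K}.ncard = 2 := by
  obtain ⟨v, hv, hvv, rfl⟩ := hK
  obtain ⟨e, k, hk, hve, hek, hind, hspan⟩ := exists_frame hs hd hv hvv
  have hev : e ⬝ᵥ Q *ᵥ v = 0 := by rw [dotProduct_mulVec_symm hs, hve]
  let P : F → Submodule F (F × (Fin 3 → F)) := fun k => Submodule.span F {(0, v), (k, e)}
  have hmem : ∀ k x, x ∈ P k ↔ ∃ a b : F, x = (b * k, a • v + b • e) := by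
    intro k x
    rw [Submodule.mem_span_pair]
    simp only [Prod.smul_mk, Prod.mk_add_mk, smul_eq_mul, mul_zero, zero_add, eq_comm]
  have hval : ∀ z a b : F, extForm Q (z, a • v + b • e) = z ^ 2 - k ^ 2 * b ^ 2 := by
    intro z a b
    simp only [extForm, mulVec_add, mulVec_smul, add_dotProduct, dotProduct_add, smul_dotProduct,
      dotProduct_smul, smul_eq_mul, hvv, hve, hev]
    linear_combination b ^ 2 * hek
  have hrank : ∀ k, Module.finrank F (P k) = 2 := by
    intro k
    have hli : LinearIndependent F ![((0 : F), v), (k, e)] := by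
      rw [LinearIndependent.pair_iff' (by simpa using hv)]
      intro a ha
      exact hind a (by simpa using congrArg Prod.snd ha)
    have := finrank_span_eq_card hli
    rw [Matrix.range_cons_cons_empty] at this
    simpa using this
  have hP : ∀ l : F, l ^ 2 = k ^ 2 → IsSingularPlane Q (P l) ∧ ∀ x ∈ P l, x.2 ∈ tangentPlane Q v := by
    intro l hl
    refine ⟨⟨hrank l, ?_⟩, ?_⟩
    · intro x hx
      obtain ⟨a, b, rfl⟩ := (hmem l x).mp hx
      rw [hval]
      linear_combination b ^ 2 * hl
    · intro x hx
      obtain ⟨a, b, rfl⟩ := (hmem l x).mp hx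
      rw [mem_tangentPlane]
      simp [mulVec_add, mulVec_smul, hvv, hve]
  have hset : {W : Submodule F (F × (Fin 3 → F)) | IsSingularPlane Q W ∧
      ∀ x ∈ W, x.2 ∈ tangentPlane Q v} = {P k, P (-k)} := by
    ext W
    simp only [Set.mem_ofPred_eq, Set.mem_insert_iff, Set.mem_singleton_iff]
    constructor
    · rintro ⟨⟨hr, hsing⟩, hWK⟩
      have hform : ∀ x ∈ W, ∃ a b : F, x = (x.1, a • v + b • e) ∧ x.1 ^ 2 = k ^ 2 * b ^ 2 := by
        intro x hx
        obtain ⟨a, b, hab⟩ := hspan x.2 (mem_tangentPlane.mp (hWK x hx))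
        have hx' : x = (x.1, a • v + b • e) := Prod.ext rfl hab.symm
        refine ⟨a, b, hx', ?_⟩
        have := hsing x hx
        rw [hx', hval] at this
        linear_combination this
      by_cases h1 : W ≤ P k
      · left
        exact Submodule.eq_of_le_of_finrank_eq h1 (by rw [hr, hrank])
      by_cases h3 : W ≤ P (-k)
      · right
        exact Submodule.eq_of_le_of_finrank_eq h3 (by rw [hr, hrank])
      -- Otherwise `W` contains `x` off the first plane and `y` off the second. Each then lies on
      -- the other plane, and singularity of `x + y` gives `4 k² b d = 0`; but `b = 0` or `d = 0`
      -- would put `x` or `y` on both planes.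
      exfalso
      obtain ⟨x, hx, hx'⟩ := SetLike.not_le_iff_exists.mp h1
      obtain ⟨y, hy, hy'⟩ := SetLike.not_le_iff_exists.mp h3
      obtain ⟨a, b, hxe, hxq⟩ := hform x hx
      obtain ⟨c, d, hye, hyq⟩ := hform y hy
      have hb : x.1 ≠ b * k := fun h => hx' ((hmem _ _).mpr ⟨a, b, by rw [hxe, h]⟩)
      have hdd : y.1 ≠ d * -k := fun h => hy' ((hmem _ _).mpr ⟨c, d, by rw [hye, h]⟩)
      have hxk : x.1 = -(b * k) := by
        have h0 : (x.1 - b * k) * (x.1 + b * k) = 0 := by linear_combination hxq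
        exact eq_neg_of_add_eq_zero_left ((mul_eq_zero.mp h0).resolve_left (sub_ne_zero.mpr hb))
      have hyk : y.1 = d * k := by
        have h0 : (y.1 - d * k) * (y.1 - d * -k) = 0 := by linear_combination hyq
        exact sub_eq_zero.mp ((mul_eq_zero.mp h0).resolve_right (sub_ne_zero.mpr hdd))
      have hxy := hsing _ (W.add_mem hx hy)
      rw [hxe, hye, Prod.mk_add_mk,
        show a • v + b • e + (c • v + d • e) = (a + c) • v + (b + d) • e by module, hval, hxk,
        hyk] at hxy
      have h4 : 2 * 2 * k ^ 2 * (b * d) = 0 := by linear_combination -hxy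
      have hbd : b * d = 0 := by simpa [h2, hk] using h4
      rcases mul_eq_zero.mp hbd with h | h
      · exact hb (by rw [hxk, h]; ring)
      · exact hdd (by rw [hyk, h]; ring)
    · rintro (rfl | rfl)
      · exact hP k rfl
      · exact hP (-k) (by ring)
  rw [hset, Set.ncard_pair]
  -- The planes differ: if `(k, e)` lay on the second one, its coefficient at `e` would be `-1`, so
  -- `2 e` would be a multiple of `v`.
  intro h
  have h1 : ((k : F), e) ∈ P (-k) := by
    rw [← h, hmem]
    exact ⟨0, 1, by simp⟩
  obtain ⟨a, b, hab⟩ := (hmem _ _).mp h1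
  have hb : b = -1 := by
    have h5 : k = b * -k := congrArg Prod.fst hab
    have h6 : (b + 1) * k = 0 := by linear_combination h5
    exact eq_neg_of_add_eq_zero_left ((mul_eq_zero.mp h6).resolve_right hk)
  have he : e = a • v + b • e := congrArg Prod.snd hab
  apply hind (a / 2)
  subst hb
  have : (2 : F) • e = a • v := by
    rw [two_smul]
    nth_rewrite 1 [he]
    module
  rw [div_eq_inv_mul, mul_smul, ← this, smul_smul, inv_mul_cancel₀ h2, one_smul]

end Planes

/-! ### The norm form in coordinates -/

theorem algebraMap_even_inj (q : IntForm 3) :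
    Function.Injective (algebraMap ℤ (CliffordAlgebra.even q)) := fun _ _ h =>
  algebraMap_inj q (congrArg (CliffordAlgebra.even q).val h)

theorem normForm_apply (q : IntForm 3) (x : Fin 4 → ℤ) : normForm q x =
      x 0 ^ 2 + x 0 * (formMatrix q 1 2 * x 1 - formMatrix q 0 2 * x 2 + formMatrix q 0 1 * x 3)
        + q (Pi.single 1 1) * q (Pi.single 2 1) * x 1 ^ 2
        + q (Pi.single 0 1) * q (Pi.single 2 1) * x 2 ^ 2
        + q (Pi.single 0 1) * q (Pi.single 1 1) * x 3 ^ 2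
        - q (Pi.single 2 1) * formMatrix q 0 1 * (x 1 * x 2)
        + (formMatrix q 0 1 * formMatrix q 1 2 - q (Pi.single 1 1) * formMatrix q 0 2)
          * (x 1 * x 3)
        - q (Pi.single 0 1) * formMatrix q 1 2 * (x 2 * x 3) :=
  algebraMap_even_inj q ((normForm_spec q x).symm.trans (mul_conj_eq q x))

/-- The coordinates at `e_23, -e_13, e_12`. -/
def imPart {R : Type*} (x : Fin 4 → R) : Fin 3 → R := fun i => x i.succ

/-- The vector `(q_23, -q_13, q_12)` of traces of the natural basis. -/
def traceVec {R : Type*} [CommRing R] (Q : Matrix (Fin 3) (Fin 3) R) : Fin 3 → R :=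
  ![Q 1 2, -Q 0 2, Q 0 1]

theorem formMatrix_symm {m : ℕ} (q : IntForm m) (i j : Fin m) : formMatrix q i j = formMatrix q j i :=
  congrFun (congrFun (formMatrix_transpose q) j) i

/-- Completing the square: the linear form is the trace of `x`, and what remains is the adjoint form
of `q`. This is how the dual of `Q` enters. -/
theorem four_mul_normForm (q : IntForm 3) (x : Fin 4 → ℤ) :
    4 * normForm q x = (2 * x 0 + traceVec (formMatrix q) ⬝ᵥ imPart x) ^ 2 +
      imPart x ⬝ᵥ (formMatrix q).adjugate *ᵥ imPart x := by
  rw [normForm_apply, adjugate_fin_three]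
  simp only [dotProduct, mulVec, Fin.sum_univ_three, of_apply, cons_val, imPart, traceVec,
    formMatrix_diag, formMatrix_symm q 1 0, formMatrix_symm q 2 0, formMatrix_symm q 2 1,
    Fin.succ_zero_eq_one, Fin.succ_one_eq_two, show (2 : Fin 3).succ = 3 from rfl]
  ring

theorem formMatrix_normForm (q : IntForm 3) : formMatrix (normForm q) =
    !![2, formMatrix q 1 2, -formMatrix q 0 2, formMatrix q 0 1;
      formMatrix q 1 2, 2 * (q (Pi.single 1 1) * q (Pi.single 2 1)),
        -(q (Pi.single 2 1) * formMatrix q 0 1),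
        formMatrix q 0 1 * formMatrix q 1 2 - q (Pi.single 1 1) * formMatrix q 0 2;
      -formMatrix q 0 2, -(q (Pi.single 2 1) * formMatrix q 0 1),
        2 * (q (Pi.single 0 1) * q (Pi.single 2 1)), -(q (Pi.single 0 1) * formMatrix q 1 2);
      formMatrix q 0 1, formMatrix q 0 1 * formMatrix q 1 2 - q (Pi.single 1 1) * formMatrix q 0 2,
        -(q (Pi.single 0 1) * formMatrix q 1 2), 2 * (q (Pi.single 0 1) * q (Pi.single 1 1))] := by
  ext i j
  change QuadraticMap.polar (normForm q) (Pi.single i 1) (Pi.single j 1) = _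
  simp only [QuadraticMap.polar, normForm_apply, Pi.add_apply]
  fin_cases i <;> fin_cases j <;> simp <;> ring

/-- Carries nonsingularity and coprimality to `p` from `q` over to its norm form. -/
theorem four_mul_formDet_normForm (q : IntForm 3) :
    4 * formDet (normForm q) = formDet q ^ 2 := by
  rw [formDet, formMatrix_normForm, formDet, det_fin_three (formMatrix q), det_succ_row_zero]
  simp only [det_fin_three, Fin.sum_univ_four, submatrix_apply, of_apply, cons_val, Fin.succAbove,
    formMatrix_diag, formMatrix_symm q 1 0, formMatrix_symm q 2 0, formMatrix_symm q 2 1]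
  simp
  ring

/-- With `c = p²` this explains the diagonal factor in the lift: once the head coordinate is
multiplied by `p²`, the norm form of `p² q` takes the value of that of `q` at `p² x`. -/
theorem normForm_smul (c : ℤ) (q : IntForm 3) (x : Fin 4 → ℤ) :
    normForm (c • q) x = normForm q ![x 0, c * x 1, c * x 2, c * x 3] := by
  simp only [normForm_apply, formMatrix_smul, Matrix.smul_apply, cons_val,
    _root_.smul_apply, smul_eq_mul]
  ring

/-! ### The lift in coordinates -/

/-- The sign in `-e_13` is chosen for this: the non-scalar part of a product of two vectors is their
cross product. -/
theorem bilin_eq_ofCoords (q : IntForm 3) (u v : Fin 3 → ℤ) :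
    ∃ c : ℤ, (CliffordAlgebra.even.ι q).bilin u v = ofCoords q (vecCons c (crossProduct u v)) := by
  have s : ∀ i, gen q i * gen q i = q (Pi.single i 1) • (1 : CliffordAlgebra q) := fun i => by
    rw [gen_sq, Algebra.algebraMap_eq_smul_one]
  have w : ∀ i j, gen q j * gen q i = formMatrix q i j • (1 : CliffordAlgebra q)
      - gen q i * gen q j := fun i j => by
    rw [gen_swap, Algebra.algebraMap_eq_smul_one]
  -- The scalar part collects the squares of the generators and the terms produced by putting `e_j
  -- e_i`, `i < j`, in order.
  refine ⟨u 0 * v 0 * q (Pi.single 0 1) + u 1 * v 1 * q (Pi.single 1 1)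
    + u 2 * v 2 * q (Pi.single 2 1) + u 1 * v 0 * formMatrix q 0 1 + u 2 * v 0 * formMatrix q 0 2
    + u 2 * v 1 * formMatrix q 1 2, Subtype.ext ?_⟩
  rw [coe_ofCoords]
  change CliffordAlgebra.ι q u * CliffordAlgebra.ι q v = _
  rw [gen_expand q u, gen_expand q v]
  simp only [Fin.sum_univ_three, add_mul, mul_add, smul_mul_assoc, mul_smul_comm, s, w 0 1, w 0 2,
    w 1 2, smul_sub, cross_apply, cons_val]
  match_scalars <;> ring

theorem repr_ofCoords (q : IntForm 3) (x : Fin 4 → ℤ) (i : Fin 4) :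
    (natBasis q).repr (ofCoords q x) i = x i := by
  rw [← Module.Basis.equivFun_apply]
  exact congrFun ((natBasis q).equivFun.apply_symm_apply x) i

theorem ofCoords_repr (q : IntForm 3) (z : CliffordAlgebra.even q) :
    ofCoords q ((natBasis q).repr z) = z :=
  (natBasis q).equivFun.symm_apply_apply z

section Lift

variable {q q'' : IntForm 3} {A : Matrix (Fin 3) (Fin 3) ℤ} (hA : A ∈ Rep q q'')

theorem evenMap_ofCoords (x : Fin 4 → ℤ) :
    evenMap hA (ofCoords q'' x) = ofCoords q (liftPhi hA *ᵥ x) := by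
  have h := LinearMap.toMatrix_mulVec_repr (natBasis q'') (natBasis q) (evenMap hA).toLinearMap
    (ofCoords q'' x)
  have h1 : ((natBasis q'').repr (ofCoords q'' x) : Fin 4 → ℤ) = x :=
    funext fun i => repr_ofCoords q'' x i
  rw [h1] at h
  rw [liftPhi, h, ofCoords_repr]
  rfl

theorem liftPhi_apply (i j : Fin 4) :
    liftPhi hA i j = (natBasis q).repr (evenMap hA (natFamily q'' j)) i := by
  rw [liftPhi, LinearMap.toMatrix_apply]
  simp [natBasis]

theorem evenMap_genMul (i j : Fin 3) : evenMap hA (genMul q'' i j) =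
    (CliffordAlgebra.even.ι q).bilin (fun k => A k i) (fun k => A k j) := by
  apply Subtype.ext
  change CliffordAlgebra.map (isometryOf hA) (gen q'' i * gen q'' j) =
    CliffordAlgebra.ι q _ * CliffordAlgebra.ι q _
  have h : ∀ i, isometryOf hA (Pi.single i 1) = fun k => A k i := by
    intro i
    change Matrix.toLin' A (Pi.single i 1) = _
    ext k
    simp
  rw [map_mul, gen, gen, CliffordAlgebra.map_apply_ι, CliffordAlgebra.map_apply_ι, h, h]

theorem liftPhi_col_zero (i : Fin 4) : liftPhi hA i 0 = (Pi.single 0 1 : Fin 4 → ℤ) i := by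
  have h0 : natBasis q 0 = 1 := by simp [natBasis, natFamily]
  rw [liftPhi_apply]
  simp only [natFamily, cons_val, map_one]
  rw [← h0, Module.Basis.repr_self, Finsupp.single_apply, Pi.single_apply]
  simp [eq_comm]

/-- The image of `e_i e_j` is the product of two columns of `A`, whose non-scalar part is their
cross product, that is, a column of cofactors. -/
theorem liftPhi_succ_succ (i j : Fin 3) : liftPhi hA i.succ j.succ = A.adjugate j i := by
  rw [liftPhi_apply, adjugate_fin_three]
  have key : ∀ k l : Fin 3, (natBasis q).repr (evenMap hA (genMul q'' k l)) i.succ =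
      crossProduct (fun a => A a k) (fun a => A a l) i := by
    intro k l
    rw [evenMap_genMul]
    obtain ⟨c, hc⟩ := bilin_eq_ofCoords q (fun a => A a k) (fun a => A a l)
    rw [hc, repr_ofCoords, cons_val_succ]
  fin_cases j
  · change (natBasis q).repr (evenMap hA (genMul q'' 1 2)) i.succ = _
    rw [key, cross_apply]
    fin_cases i <;> simp <;> ring
  · change (natBasis q).repr (evenMap hA (-genMul q'' 0 2)) i.succ = _
    rw [map_neg, map_neg, Finsupp.neg_apply, key, cross_apply]
    fin_cases i <;> simp <;> ring
  · change (natBasis q).repr (evenMap hA (genMul q'' 0 1)) i.succ = _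
    rw [key, cross_apply]
    fin_cases i <;> simp <;> ring

theorem map_star (f : q'' →qᵢ q) (x : CliffordAlgebra q'') :
    CliffordAlgebra.map f (star x) = star (CliffordAlgebra.map f x) := by
  induction x using CliffordAlgebra.induction with
  | algebraMap r => simp only [CliffordAlgebra.star_algebraMap, AlgHom.commutes]
  | ι x => simp only [CliffordAlgebra.star_ι, map_neg, CliffordAlgebra.map_apply_ι]
  | mul x y hx hy => simp only [star_mul, map_mul, hx, hy]
  | add x y hx hy => simp only [star_add, map_add, hx, hy]

/-- The lift preserves norms. -/
theorem normForm_liftPhi (x : Fin 4 → ℤ) : normForm q (liftPhi hA *ᵥ x) = normForm q'' x := by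
  apply algebraMap_even_inj q
  rw [← normForm_spec, ← evenMap_ofCoords]
  have h : conj q (evenMap hA (ofCoords q'' x)) = evenMap hA (conj q'' (ofCoords q'' x)) :=
    Subtype.ext (map_star _ _).symm
  rw [h, ← map_mul, normForm_spec, AlgHom.commutes]

end Lift

/-! ### Similitudes and their multipliers -/

section Substitution

variable {m : ℕ}

theorem subst_smul_one (c : ℤ) (q : IntForm m) :
    subst q (c • (1 : Matrix (Fin m) (Fin m) ℤ)) = c ^ 2 • q := by
  ext x
  simp only [subst_apply, smul_mulVec, one_mulVec, QuadraticMap.map_smul, smul_eq_mul,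
    _root_.smul_apply]
  ring

theorem smul_subst {n : ℕ} (c : ℤ) (q : IntForm m) (A : Matrix (Fin m) (Fin n) ℤ) :
    subst (c • q) A = c • subst q A := rfl

/-- If `A ∈ R(q', c q)` and `A B = c`, then `B ∈ R(q, c q')`. -/
theorem mem_Rep_of_mul_eq {c : ℤ} (hc : c ≠ 0) {q q' : IntForm m} {A B : Matrix (Fin m) (Fin m) ℤ}
    (hA : A ∈ Rep q' (c • q)) (hAB : A * B = c • 1) : B ∈ Rep q (c • q') := by
  apply form_ext_of_smul hc
  have h : subst q' A = c • q := hA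
  rw [← smul_subst, ← h, ← subst_mul, hAB, subst_smul_one, smul_smul, sq]

theorem formMatrix_of_mem_Rep {c : ℤ} {q q' : IntForm m} {A : Matrix (Fin m) (Fin m) ℤ}
    (hA : A ∈ Rep q' (c • q)) : Aᵀ * formMatrix q' * A = c • formMatrix q := by
  have h : subst q' A = c • q := hA
  rw [← formMatrix_subst, h, formMatrix_smul]

theorem det_sq_of_mem_Rep {c : ℤ} {q q' : IntForm m} {A : Matrix (Fin m) (Fin m) ℤ}
    (hA : A ∈ Rep q' (c • q)) (hd : formDet q' = formDet q) (h0 : formDet q ≠ 0) :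
    A.det ^ 2 = c ^ m := by
  have h := congrArg Matrix.det (formMatrix_of_mem_Rep hA)
  rw [det_mul, det_mul, det_transpose, det_smul, Fintype.card_fin] at h
  change A.det * formDet q' * A.det = c ^ m * formDet q at h
  rw [hd] at h
  apply mul_right_cancel₀ h0
  linear_combination h

end Substitution

/-! ### Integral matrices and divisibility at a prime -/

section Prime

variable {p : ℕ} [hp : Fact p.Prime] {m : ℕ}

theorem prime_ne_zero : (p : ℤ) ≠ 0 := by exact_mod_cast hp.out.ne_zero

theorem cast_ne_zero_of_isCoprime {d : ℤ} (h : IsCoprime (p : ℤ) d) : (d : ZMod p) ≠ 0 := by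
  rw [Ne, ZMod.intCast_zmod_eq_zero_iff_dvd]
  intro hd
  have := h.isUnit_of_dvd' dvd_rfl hd
  exact (Nat.prime_iff_prime_int.mp hp.out).not_isUnit this

theorem smul_mat_cancel {n : ℕ} {c : ℤ} (hc : c ≠ 0) {A B : Matrix (Fin m) (Fin n) ℤ}
    (h : c • A = c • B) : A = B := by
  ext i j
  have := congrFun (congrFun h i) j
  simpa [hc] using this

theorem exists_of_smul_eq_smul {n : ℕ} {c d : ℤ} (hd : IsCoprime c d)
    {A B : Matrix (Fin m) (Fin n) ℤ} (h : d • A = c • B) : ∃ C, A = c • C := by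
  have h1 : ∀ i j, c ∣ A i j := fun i j => by
    have h2 : d * A i j = c * B i j := congrFun (congrFun h i) j
    exact hd.dvd_of_dvd_mul_left ⟨_, h2⟩
  choose C hC using h1
  exact ⟨C, Matrix.ext hC⟩

/-- Here `A' = p A⁻¹`. Its image reduces into the kernel of `A`, hence into that of `B`, so `B A'`
is divisible by `p` and the quotient is `B A⁻¹`. -/
theorem kernel_le_factor {A B A' : Matrix (Fin m) (Fin m) ℤ} (hAB : A * A' = (p : ℤ) • 1)
    (hBA : A' * A = (p : ℤ) • 1) (h : kerMod p A ≤ kerMod p B) : ∃ X, B = X * A := by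
  obtain ⟨X, hX⟩ := exists_mul_eq_smul p (A := B) (B := A') (fun x => h <| by
    rw [redVec_mem_kerMod, mulVec_mulVec, hAB]
    exact ⟨x, by rw [smul_mulVec, one_mulVec]⟩)
  refine ⟨X, smul_mat_cancel prime_ne_zero (c := (p : ℤ)) ?_⟩
  calc (p : ℤ) • B = B * (A' * A) := by rw [hBA, Matrix.mul_smul, Matrix.mul_one]
    _ = (p : ℤ) • (X * A) := by rw [← Matrix.mul_assoc, hX, Matrix.smul_mul]

/-! ### Sublattices with elementary divisors `1` and `p` -/

/-- Allows elimination over `𝔽_p` to be performed by integral matrices of determinant one. -/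
theorem exists_lift_transvections (L : List (TransvectionStruct (Fin m) (ZMod p))) :
    ∃ R R' : Matrix (Fin m) (Fin m) ℤ, R * R' = 1 ∧ R' * R = 1 ∧ R.det = 1 ∧
      redMat p R = (L.map TransvectionStruct.toMatrix).prod := by
  induction L with
  | nil => exact ⟨1, 1, by simp, by simp, by simp, by simp [redMat_one]⟩
  | cons t L ih =>
    obtain ⟨R, R', h1, h2, h3, h4⟩ := ih
    obtain ⟨c, hc⟩ := ZMod.intCast_surjective t.c
    have e1 : transvection t.i t.j c * transvection t.i t.j (-c) = 1 := by
      rw [transvection_mul_transvection_same _ _ t.hij]; simp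
    have e2 : transvection t.i t.j (-c) * transvection t.i t.j c = 1 := by
      rw [transvection_mul_transvection_same _ _ t.hij]; simp
    refine ⟨transvection t.i t.j c * R, R' * transvection t.i t.j (-c), ?_, ?_, ?_, ?_⟩
    · rw [Matrix.mul_assoc, ← Matrix.mul_assoc R, h1, Matrix.one_mul, e1]
    · rw [Matrix.mul_assoc, ← Matrix.mul_assoc _ _ R, e2, Matrix.one_mul, h2]
    · rw [det_mul, h3, det_transvection_of_ne _ _ t.hij, mul_one]
    · rw [redMat_mul, h4, List.map_cons, List.prod_cons]
      congr 1
      rw [TransvectionStruct.toMatrix, ← hc]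
      ext i j
      simp only [redMat, transvection, Matrix.map_apply, Matrix.add_apply, Matrix.single_apply,
        Matrix.one_apply, map_add, apply_ite (Int.castRingHom (ZMod p)), map_one, map_zero,
        eq_intCast]

/-- A projection with kernel `W` is diagonalised by transvections on both sides. The left ones do
not affect the kernel; the right ones lift to `R` over `ℤ`. -/
theorem exists_matrix_kerMod_eq (W : Submodule (ZMod p) (Fin m → ZMod p)) :
    ∃ C C' : Matrix (Fin m) (Fin m) ℤ, C * C' = (p : ℤ) • 1 ∧ C' * C = (p : ℤ) • 1 ∧
      C.det = (p : ℤ) ^ Module.finrank (ZMod p) W ∧ kerMod p C = W := by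
  obtain ⟨W', hW⟩ := W.exists_isCompl
  obtain ⟨f, hf⟩ : ∃ f : (Fin m → ZMod p) →ₗ[ZMod p] (Fin m → ZMod p), LinearMap.ker f = W :=
    ⟨_, Submodule.ker_projection hW.symm⟩
  obtain ⟨L, L', D, hLD⟩ := Pivot.exists_list_transvec_mul_diagonal_mul_list_transvec
    (LinearMap.toMatrix' f)
  obtain ⟨S, S', hS, hS', -, hSr⟩ := exists_lift_transvections L
  obtain ⟨R, R', hR, hR', hRd, hRr⟩ := exists_lift_transvections L'
  rw [← hSr, ← hRr] at hLD
  have hmem : ∀ x, x ∈ W ↔ ∀ i, D i * (redMat p R *ᵥ x) i = 0 := by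
    intro x
    rw [← hf, LinearMap.mem_ker, ← LinearMap.toMatrix'_mulVec, hLD, ← mulVec_mulVec,
      ← mulVec_mulVec]
    constructor
    · intro h i
      have h1 := congrArg (redMat p S' *ᵥ ·) h
      rw [mulVec_mulVec, ← redMat_mul, hS', redMat_one, one_mulVec, mulVec_zero] at h1
      simpa [mulVec_diagonal] using congrFun h1 i
    · intro h
      rw [show diagonal D *ᵥ (redMat p R *ᵥ x) = 0 from funext fun i => by
        rw [mulVec_diagonal]; exact h i, mulVec_zero]
  have hrank : Module.finrank (ZMod p) W = (Finset.univ.filter fun i => D i = 0).card := by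
    have h1 := LinearMap.finrank_range_add_finrank_ker f
    have h2 : (LinearMap.toMatrix' f).rank = Module.finrank (ZMod p) (LinearMap.range f) := by
      rw [Matrix.rank, ← Matrix.toLin'_apply', Matrix.toLin'_toMatrix']
    have hu : ∀ {T T' : Matrix (Fin m) (Fin m) ℤ}, T * T' = 1 → IsUnit (redMat p T).det := by
      intro T T' h
      apply (Matrix.isUnit_iff_isUnit_det _).mp
      exact IsUnit.of_mul_eq_one (redMat p T') (by rw [← redMat_mul, h, redMat_one])
    rw [hLD, rank_mul_eq_left_of_isUnit_det _ _ (hu hR), rank_mul_eq_right_of_isUnit_det _ _ (hu hS),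
      rank_diagonal, Fintype.card_subtype] at h2
    rw [hf, ← h2, Module.finrank_fin_fun] at h1
    have h3 := Finset.card_filter_add_card_filter_not (s := (Finset.univ : Finset (Fin m)))
      (fun i => D i = 0)
    rw [Finset.card_univ, Fintype.card_fin] at h3
    simp only [ne_eq] at h1
    omega
  have hdd : (diagonal fun i => if D i = 0 then (p : ℤ) else 1) *
      (diagonal fun i => if D i = 0 then 1 else (p : ℤ)) = (p : ℤ) • 1 := by
    rw [diagonal_mul_diagonal, smul_one_eq_diagonal]
    congr 1
    ext i
    split_ifs <;> simp
  -- The entry `p` stands exactly where `D` vanishes, so modulo `p` the diagonal matrix has the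
  -- kernel of `D`.
  refine ⟨diagonal (fun i => if D i = 0 then (p : ℤ) else 1) * R,
    R' * diagonal (fun i => if D i = 0 then 1 else (p : ℤ)), ?_, ?_, ?_, ?_⟩
  · rw [Matrix.mul_assoc, ← Matrix.mul_assoc R, hR, Matrix.one_mul, hdd]
  · rw [Matrix.mul_assoc, ← Matrix.mul_assoc _ _ R, diagonal_mul_diagonal]
    simp only [mul_comm (ite _ _ _) (ite _ _ _)]
    rw [← diagonal_mul_diagonal, hdd, Matrix.smul_mul, Matrix.one_mul, Matrix.mul_smul, hR']
  · rw [det_mul, hRd, mul_one, det_diagonal, Finset.prod_ite, hrank]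
    simp
  · ext x
    rw [mem_kerMod, hmem, redMat_mul, ← mulVec_mulVec]
    have hr : redMat p (diagonal fun i => if D i = 0 then (p : ℤ) else 1) =
        diagonal fun i => if D i = 0 then 0 else 1 := by
      ext i j
      by_cases hij : i = j
      · subst hij
        by_cases hi : D i = 0 <;> simp [redMat, hi]
      · simp [redMat, hij]
    rw [hr, funext_iff]
    apply forall_congr'
    intro i
    rw [mulVec_diagonal]
    by_cases hi : D i = 0 <;> simp [hi]

/-! ### Quaternary automorphs with multiplier `p` -/

section Quaternary

variable {n n₁ n₂ : IntForm 4} {M M₁ M₂ : Matrix (Fin 4) (Fin 4) ℤ}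

/-- The matrix sought is `p M⁻¹`. The relation `ᵗM N₁ M = p N` shows that `det N · p M⁻¹` is
integral, while `det M = ± p²` allows only powers of `p` as denominators; `p` is prime to `det N`.
-/
theorem exists_conjugate (hd : formDet n₁ = formDet n) (h0 : formDet n ≠ 0)
    (hc : IsCoprime (p : ℤ) (formDet n)) (hM : M ∈ Rep n₁ ((p : ℤ) • n)) :
    ∃ M', M * M' = (p : ℤ) • 1 ∧ M' * M = (p : ℤ) • 1 := by
  have hp0 : (p : ℤ) ≠ 0 := prime_ne_zero
  have hsq := det_sq_of_mem_Rep hM hd h0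
  obtain ⟨ε, hε, hdet⟩ : ∃ ε : ℤ, ε * ε = 1 ∧ M.det = ε * (p : ℤ) ^ 2 := by
    have : M.det ^ 2 = ((p : ℤ) ^ 2) ^ 2 := by rw [hsq]; ring
    rcases sq_eq_sq_iff_eq_or_eq_neg.mp this with h | h
    · exact ⟨1, by norm_num, by rw [h]; ring⟩
    · exact ⟨-1, by norm_num, by rw [h]; ring⟩
  have h1 : (formMatrix n).adjugate * Mᵀ * formMatrix n₁ * M = ((p : ℤ) * formDet n) • 1 := by
    rw [Matrix.mul_assoc, Matrix.mul_assoc, ← Matrix.mul_assoc Mᵀ, formMatrix_of_mem_Rep hM,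
      Matrix.mul_smul, adjugate_mul, smul_smul]
    rfl
  have h2 : formDet n • M.adjugate =
      (p : ℤ) • (ε • ((formMatrix n).adjugate * Mᵀ * formMatrix n₁)) := by
    apply smul_mat_cancel hp0
    have h3 := congrArg (· * M.adjugate) h1
    simp only [Matrix.mul_assoc _ M, mul_adjugate, Matrix.smul_mul, Matrix.one_mul, Matrix.mul_smul,
      Matrix.mul_one, hdet] at h3
    rw [smul_smul, ← h3, smul_smul, smul_smul]
    congr 1
    ring
  obtain ⟨B, hB⟩ := exists_of_smul_eq_smul hc h2
  have e1 : M * (ε • B) = (p : ℤ) • 1 := by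
    apply smul_mat_cancel hp0
    have h4 := mul_adjugate M
    rw [hB, hdet, Matrix.mul_smul] at h4
    rw [Matrix.mul_smul, smul_comm, h4, smul_smul, smul_smul]
    congr 1
    linear_combination ((p : ℤ) ^ 2) * hε
  have e2 : (ε • B) * M = (p : ℤ) • 1 := by
    apply smul_mat_cancel hp0
    have h4 := adjugate_mul M
    rw [hB, hdet, Matrix.smul_mul] at h4
    rw [Matrix.smul_mul, smul_comm, h4, smul_smul, smul_smul]
    congr 1
    linear_combination ((p : ℤ) ^ 2) * hε
  exact ⟨_, e1, e2⟩

/-- Modulo `p` the image of `M` is totally isotropic in a nondegenerate space of dimension four. -/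
theorem rank_redMat_le (hc : IsCoprime (p : ℤ) (formDet n₁)) (hM : M ∈ Rep n₁ ((p : ℤ) • n)) :
    (redMat p M).rank ≤ 2 := by
  have h := congrArg (redMat p) (formMatrix_of_mem_Rep hM)
  rw [redMat_prime_smul, Matrix.mul_assoc, redMat_mul, redMat_mul, redMat_transpose] at h
  have h1 := rank_add_rank_le_card_of_mul_eq_zero h
  rw [rank_transpose, rank_mul_eq_right_of_isUnit_det, Fintype.card_fin] at h1
  · omega
  · rw [redMat_det, isUnit_iff_ne_zero]
    exact cast_ne_zero_of_isCoprime hc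

/-- From `M x = p y` follows `x = M' y`, so the kernel of `M` lies in the image of its conjugate
`M'`. Both matrices have rank at most two, which bounds the kernel from both sides. -/
theorem finrank_kerMod_eq_two (hd : formDet n₁ = formDet n) (h0 : formDet n ≠ 0)
    (hc : IsCoprime (p : ℤ) (formDet n)) (hM : M ∈ Rep n₁ ((p : ℤ) • n)) :
    Module.finrank (ZMod p) (kerMod p M) = 2 := by
  obtain ⟨M', h1, h2⟩ := exists_conjugate hd h0 hc hM
  have hM' := mem_Rep_of_mul_eq prime_ne_zero hM h1
  have r1 := rank_redMat_le (hd ▸ hc) hM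
  have r2 := rank_redMat_le hc hM'
  have hle : kerMod p M ≤ LinearMap.range (redMat p M').mulVecLin := by
    intro x hx
    obtain ⟨x, rfl⟩ := redVec_surjective p x
    obtain ⟨y, hy⟩ := (redVec_mem_kerMod p).mp hx
    refine ⟨redVec p y, ?_⟩
    rw [mulVecLin_apply, ← redVec_mulVec]
    congr 1
    have h3 := congrArg (M' *ᵥ ·) hy
    simp only [mulVec_mulVec, h2, smul_mulVec, one_mulVec, mulVec_smul] at h3
    exact (smul_right_injective _ prime_ne_zero h3).symm
  have h3 := Submodule.finrank_mono hle
  have h4 := LinearMap.finrank_range_add_finrank_ker (redMat p M).mulVecLin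
  rw [Module.finrank_fin_fun] at h4
  rw [Matrix.rank] at r1 r2
  unfold kerMod at *
  omega

/-- If `M x = p y`, then `p n(x) = p² n₁(y)`: the kernel is totally singular for `n`. -/
theorem dvd_of_redVec_mem_kerMod (hM : M ∈ Rep n₁ ((p : ℤ) • n)) {x : Fin 4 → ℤ}
    (hx : redVec p x ∈ kerMod p M) : (p : ℤ) ∣ n x := by
  obtain ⟨y, hy⟩ := (redVec_mem_kerMod p).mp hx
  have h : n₁ (M *ᵥ x) = (p : ℤ) * n x := DFunLike.congr_fun (show subst n₁ M = (p : ℤ) • n from hM) x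
  rw [hy, QuadraticMap.map_smul, smul_eq_mul, mul_assoc] at h
  exact ⟨n₁ y, (mul_left_cancel₀ prime_ne_zero h).symm⟩

theorem exists_unit_of_kerMod_eq (hd : formDet n₁ = formDet n) (hd' : formDet n₂ = formDet n)
    (h0 : formDet n ≠ 0) (hc : IsCoprime (p : ℤ) (formDet n)) (hM : M₁ ∈ Rep n₁ ((p : ℤ) • n))
    (hM' : M₂ ∈ Rep n₂ ((p : ℤ) • n)) (h : kerMod p M₁ = kerMod p M₂) :
    ∃ U : Matrix.GeneralLinearGroup (Fin 4) ℤ, M₂ = (U : Matrix (Fin 4) (Fin 4) ℤ) * M₁ := by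
  obtain ⟨M₁', h1, h2⟩ := exists_conjugate hd h0 hc hM
  obtain ⟨M₂', h3, h4⟩ := exists_conjugate hd' h0 hc hM'
  obtain ⟨X, hX⟩ := kernel_le_factor h1 h2 h.le
  obtain ⟨Y, hY⟩ := kernel_le_factor h3 h4 h.ge
  refine exists_unit_of_left_factors ?_ hX hY
  have := det_sq_of_mem_Rep hM hd h0
  intro h5
  rw [h5] at this
  exact pow_ne_zero 4 prime_ne_zero (this.symm.trans (by norm_num))

/-- Take `C` with kernel `W` and `C' = p C⁻¹`. The image of `C'` reduces into `W`, so `n[C']` is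
divisible by `p`, and `n' = n[C'] / p` works. Dimension two gives `det C' = p²`, so the determinant
of the form is preserved. -/
theorem exists_Rep_of_singular (hc : IsCoprime (p : ℤ) (formDet n)) {W : Submodule (ZMod p) (Fin 4 → ZMod p)}
    (hr : Module.finrank (ZMod p) W = 2) (hW : ∀ x, redVec p x ∈ W → (p : ℤ) ∣ n x) :
    ∃ (n' : IntForm 4) (M : Matrix (Fin 4) (Fin 4) ℤ), Similar n n' ∧ M ∈ Rep n' ((p : ℤ) • n) ∧
      kerMod p M = W := by
  obtain ⟨C, C', h1, h2, hdet, hk⟩ := exists_matrix_kerMod_eq W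
  have hp0 : (p : ℤ) ≠ 0 := prime_ne_zero
  obtain ⟨n', hn'⟩ := exists_form_of_dvd hp0 (subst n C') (fun x => hW (C' *ᵥ x) (by
    rw [← hk, redVec_mem_kerMod, mulVec_mulVec, h1]
    exact ⟨x, by rw [smul_mulVec, one_mulVec]⟩))
  have hdet' : C'.det = (p : ℤ) ^ 2 := by
    have h3 := congrArg Matrix.det h1
    rw [det_mul, hdet, hr, det_smul, det_one, Fintype.card_fin] at h3
    apply mul_left_cancel₀ (pow_ne_zero 2 hp0)
    rw [h3]; ring
  have hC' : C' ∈ Rep n ((p : ℤ) • n') := hn'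
  refine ⟨n', C, ⟨?_, (p : ℤ), hp0, hc, C', hC'⟩, mem_Rep_of_mul_eq hp0 hC' h2, hk⟩
  have h3 := congrArg Matrix.det (formMatrix_of_mem_Rep hC')
  rw [det_mul, det_mul, det_transpose, det_smul, Fintype.card_fin, hdet'] at h3
  apply mul_left_cancel₀ (pow_ne_zero 4 hp0)
  unfold formDet
  linear_combination h3

end Quaternary

end Prime

/-! ### Primitive ternary automorphs with multiplier `p²` -/

/-- A symmetric matrix of odd size with even diagonal has even determinant. Hence a prime coprime to
`det q` is automatically odd. -/
theorem two_dvd_formDet (q : IntForm 3) : 2 ∣ formDet q := by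
  rw [formDet, det_fin_three]
  simp only [formMatrix_diag, formMatrix_symm q 1 0, formMatrix_symm q 2 0, formMatrix_symm q 2 1]
  exact ⟨4 * (q (Pi.single 0 1) * q (Pi.single 1 1) * q (Pi.single 2 1))
    - q (Pi.single 0 1) * formMatrix q 1 2 ^ 2 - q (Pi.single 1 1) * formMatrix q 0 2 ^ 2
    - q (Pi.single 2 1) * formMatrix q 0 1 ^ 2
    + formMatrix q 0 1 * formMatrix q 1 2 * formMatrix q 0 2, by ring⟩

section Ternary

variable {p : ℕ} {q q₁ q₂ : IntForm 3} {A A₁ A₂ : Matrix (Fin 3) (Fin 3) ℤ}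

theorem exists_sign (hd : formDet q₁ = formDet q) (h0 : formDet q ≠ 0)
    (hA : A ∈ Rep q₁ ((p : ℤ) ^ 2 • q)) : ∃ ε : ℤ, ε * ε = 1 ∧ A.det = ε * (p : ℤ) ^ 3 := by
  have : A.det ^ 2 = ((p : ℤ) ^ 3) ^ 2 := by rw [det_sq_of_mem_Rep hA hd h0]; ring
  rcases sq_eq_sq_iff_eq_or_eq_neg.mp this with h | h
  · exact ⟨1, by norm_num, by rw [h]; ring⟩
  · exact ⟨-1, by norm_num, by rw [h]; ring⟩

variable [hp : Fact p.Prime]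

theorem two_ne_zero_of_isCoprime (hc : IsCoprime (p : ℤ) (formDet q)) : (2 : ZMod p) ≠ 0 := by
  intro h
  obtain ⟨d, hd⟩ := two_dvd_formDet q
  apply cast_ne_zero_of_isCoprime hc
  rw [hd]; push_cast; rw [h, zero_mul]

/-- The dual similitude: `A adj(Q) ᵗA = p² adj(Q₁)`. -/
theorem mul_adjugate_formMatrix_mul (hd : formDet q₁ = formDet q) (h0 : formDet q ≠ 0)
    (hA : A ∈ Rep q₁ ((p : ℤ) ^ 2 • q)) :
    A * (formMatrix q).adjugate * Aᵀ = (p : ℤ) ^ 2 • (formMatrix q₁).adjugate := by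
  have hp0 : (p : ℤ) ≠ 0 := prime_ne_zero
  have h := congrArg adjugate (formMatrix_of_mem_Rep hA)
  rw [adjugate_mul_distrib, adjugate_mul_distrib, adjugate_smul, Fintype.card_fin,
    ← adjugate_transpose] at h
  have h1 := congrArg (fun X => A * X * Aᵀ) h
  have h2 : A * (A.adjugate * ((formMatrix q₁).adjugate * A.adjugateᵀ)) * Aᵀ =
      A.det ^ 2 • (formMatrix q₁).adjugate := by
    rw [← Matrix.mul_assoc, mul_adjugate, Matrix.mul_assoc, Matrix.mul_assoc, ← transpose_mul,
      mul_adjugate, Matrix.smul_mul, Matrix.one_mul, transpose_smul, transpose_one, Matrix.mul_smul,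
      Matrix.mul_one, smul_smul, sq]
  simp only [h2, det_sq_of_mem_Rep hA hd h0, Matrix.mul_smul, Matrix.smul_mul] at h1
  -- The adjugate of `p² Q` is `p⁴ adj Q` and `det A² = p⁶`; cancelling `p⁴` leaves the multiplier
  -- `p²`.
  apply smul_mat_cancel (pow_ne_zero 4 hp0)
  rw [smul_smul]
  calc _ = ((p : ℤ) ^ 2) ^ (3 - 1) • (A * (formMatrix q).adjugate * Aᵀ) := by
        congr 1; ring
    _ = _ := by rw [← h1]; congr 1; ring

theorem redMat_ne_zero_of_mem_PrimRep {r : IntForm 3} (hA : A ∈ PrimRep q₁ r) :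
    redMat p A ≠ 0 := by
  intro h
  obtain ⟨B, rfl⟩ := (redMat_eq_zero p A).mp h
  exact (Nat.prime_iff_prime_int.mp hp.out).not_isUnit (hA.2 p fun i j => ⟨B i j, rfl⟩)

/-- The reduction of a primitive automorph has rank one, and its rows are isotropic for the
dual form. -/
theorem exists_row (hd : formDet q₁ = formDet q) (h0 : formDet q ≠ 0)
    (hc : IsCoprime (p : ℤ) (formDet q)) (hA : A ∈ PrimRep q₁ ((p : ℤ) ^ 2 • q)) :
    ∃ b : Fin 3 → ZMod p, b ≠ 0 ∧ b ⬝ᵥ (redMat p (formMatrix q)).adjugate *ᵥ b = 0 ∧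
      ∀ y, y ∈ kerMod p A ↔ b ⬝ᵥ y = 0 := by
  set S := (redMat p (formMatrix q)).adjugate with hS
  have hdet : (redMat p (formMatrix q)).det ≠ 0 := by
    rw [redMat_det]; exact cast_ne_zero_of_isCoprime hc
  have hSd : S.det ≠ 0 := by rw [hS, det_adjugate]; exact pow_ne_zero _ hdet
  have hSs : Sᵀ = S := by
    rw [hS, adjugate_transpose, ← redMat_transpose, formMatrix_transpose]
  -- Modulo `p` the rows are isotropic and mutually orthogonal for the dual form, so all of them are
  -- multiples of one nonzero row.
  have hrow : ∀ r s, redMat p A r ⬝ᵥ S *ᵥ redMat p A s = 0 := by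
    intro r s
    have h := congrArg (redMat p) (mul_adjugate_formMatrix_mul hd h0 hA.1)
    rw [redMat_mul, redMat_mul, redMat_adjugate, ← hS, sq, ← smul_smul, redMat_prime_smul,
      redMat_transpose, Matrix.mul_assoc] at h
    exact congrFun (congrFun h r) s
  obtain ⟨r, hr⟩ : ∃ r, redMat p A r ≠ 0 := by
    by_contra! h
    exact redMat_ne_zero_of_mem_PrimRep hA (funext h)
  refine ⟨redMat p A r, hr, hrow r r, fun y => ?_⟩
  rw [mem_kerMod]
  constructor
  · intro h
    exact congrFun h r
  · intro h
    funext s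
    obtain ⟨c, hc⟩ := parallel_of_isotropic hSs hSd hr (hrow r r) (hrow s s) (hrow r s)
    change redMat p A s ⬝ᵥ y = 0
    rw [hc, smul_dotProduct, h, smul_zero]

/-- If the kernel is `b · y = 0`, the point of contact is `v = adj(Q) b`, because `Q v = det Q · b`;
isotropy of `b` for the dual form becomes isotropy of `v`. -/
theorem isTangent_kerMod (hd : formDet q₁ = formDet q) (h0 : formDet q ≠ 0)
    (hc : IsCoprime (p : ℤ) (formDet q)) (hA : A ∈ PrimRep q₁ ((p : ℤ) ^ 2 • q)) :
    IsTangent (redMat p (formMatrix q)) (kerMod p A) := by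
  obtain ⟨b, hb, hbb, hker⟩ := exists_row hd h0 hc hA
  have hdet : (redMat p (formMatrix q)).det ≠ 0 := by
    rw [redMat_det]; exact cast_ne_zero_of_isCoprime hc
  have hs : (redMat p (formMatrix q))ᵀ = redMat p (formMatrix q) := by
    rw [← redMat_transpose, formMatrix_transpose]
  generalize redMat p (formMatrix q) = Q at *
  have hQv : Q *ᵥ (Q.adjugate *ᵥ b) = Q.det • b := by
    rw [mulVec_mulVec, mul_adjugate, smul_mulVec, one_mulVec]
  refine ⟨Q.adjugate *ᵥ b, ?_, ?_, ?_⟩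
  · intro h
    rw [h, mulVec_zero] at hQv
    exact hb ((smul_eq_zero.mp hQv.symm).resolve_left hdet)
  · rw [hQv, dotProduct_smul, dotProduct_comm, hbb, smul_zero]
  · ext y
    rw [hker, mem_tangentPlane, dotProduct_mulVec_symm hs, hQv, dotProduct_smul, dotProduct_comm]
    simp [hdet]

/-- With integers `l, m` lifting `α, β`, the vector `m a - l a'` is `p d`. Expanding `S[p d]` shows
that `p²` divides `2 l m` times the mixed product, and `2 l m` is prime to `p`. -/
theorem dvd_of_parallel {n : ℕ} {S : Matrix (Fin n) (Fin n) ℤ} (hS : Sᵀ = S)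
    (h2 : (2 : ZMod p) ≠ 0) {a a' : Fin n → ℤ} {b : Fin n → ZMod p} {α β : ZMod p} (hα : α ≠ 0)
    (hβ : β ≠ 0) (ha : redVec p a = α • b) (ha' : redVec p a' = β • b)
    (h : (p : ℤ) ^ 2 ∣ a ⬝ᵥ S *ᵥ a) (h' : (p : ℤ) ^ 2 ∣ a' ⬝ᵥ S *ᵥ a') :
    (p : ℤ) ^ 2 ∣ a ⬝ᵥ S *ᵥ a' := by
  obtain ⟨l, rfl⟩ := ZMod.intCast_surjective α
  obtain ⟨m, rfl⟩ := ZMod.intCast_surjective β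
  obtain ⟨d, hd⟩ : ∃ d, m • a - l • a' = (p : ℤ) • d := by
    rw [← redVec_eq_zero]
    ext i
    have h1 := congrFun ha i
    have h2 := congrFun ha' i
    simp only [redVec, Pi.smul_apply, smul_eq_mul] at h1 h2
    simp only [redVec, Pi.sub_apply, Pi.smul_apply, smul_eq_mul, Pi.zero_apply]
    push_cast
    rw [h1, h2]; ring
  have key := congrArg (fun x => x ⬝ᵥ S *ᵥ x) hd
  simp only [mulVec_sub, mulVec_smul, sub_dotProduct, dotProduct_sub, smul_dotProduct,
    dotProduct_smul, smul_eq_mul] at key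
  rw [dotProduct_mulVec_symm hS a' a] at key
  obtain ⟨u, hu⟩ := h
  obtain ⟨v, hv⟩ := h'
  have hdvd : (p : ℤ) ^ 2 ∣ (2 * l * m) * (a ⬝ᵥ S *ᵥ a') :=
    ⟨m ^ 2 * u + l ^ 2 * v - d ⬝ᵥ S *ᵥ d, by
      rw [hu, hv] at key
      linear_combination -key⟩
  apply IsCoprime.dvd_of_dvd_mul_left _ hdvd
  apply IsCoprime.pow_left
  rw [(Nat.prime_iff_prime_int.mp hp.out).coprime_iff_not_dvd,
    ← ZMod.intCast_zmod_eq_zero_iff_dvd]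
  push_cast
  exact mul_ne_zero (mul_ne_zero h2 hα) hβ

theorem exists_column {n k : ℕ} {b : Fin n → ZMod p} (hb : b ≠ 0) {X : Matrix (Fin k) (Fin n) ℤ}
    (h : ∀ y, b ⬝ᵥ y = 0 → y ∈ kerMod p X) :
    ∃ u : Fin k → ZMod p, ∀ v, redVec p (Xᵀ *ᵥ v) = (u ⬝ᵥ redVec p v) • b := by
  obtain ⟨l, hl⟩ := Function.ne_iff.mp hb
  simp only [Pi.zero_apply] at hl
  have hcol : ∀ r s, redMat p X r s = (redMat p X r l * (b l)⁻¹) * b s := by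
    intro r s
    -- The test vector is `e_s - (b_s / b_l) e_l`, which is annihilated by `b`.
    have h1 := h (Pi.single s 1 - (b s * (b l)⁻¹) • Pi.single l 1) (by
      rw [dotProduct_sub, dotProduct_smul]
      simp [hl])
    rw [mem_kerMod] at h1
    have h2 := congrFun h1 r
    simp only [mulVec_sub, mulVec_smul, Pi.sub_apply, Pi.smul_apply, mulVec_single_one, col_apply,
      smul_eq_mul, Pi.zero_apply] at h2
    linear_combination h2
  refine ⟨fun r => redMat p X r l * (b l)⁻¹, fun v => ?_⟩
  rw [redVec_mulVec, redMat_transpose]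
  ext s
  simp only [mulVec, dotProduct, transpose_apply, Pi.smul_apply, smul_eq_mul, Finset.sum_mul]
  apply Finset.sum_congr rfl
  intro r _
  rw [hcol r s]; ring

/-- A bilinear divisibility known off the hyperplane `u = 0` extends to all vectors by differences.
A `v` off the hyperplane is written `2 v - v`, which needs `p` odd. -/
theorem exists_sub_of_functional {k : ℕ} (h2 : (2 : ZMod p) ≠ 0) {u : Fin k → ZMod p} (hu : u ≠ 0)
    (v : Fin k → ℤ) :
    ∃ v₁ v₂, v = v₁ - v₂ ∧ u ⬝ᵥ redVec p v₁ ≠ 0 ∧ u ⬝ᵥ redVec p v₂ ≠ 0 := by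
  have hadd : ∀ x y : Fin k → ℤ, redVec p (x + y) = redVec p x + redVec p y := fun x y => by
    ext; simp [redVec]
  by_cases h : u ⬝ᵥ redVec p v = 0
  · obtain ⟨l, hl⟩ := Function.ne_iff.mp hu
    have h1 : u ⬝ᵥ redVec p (Pi.single l 1) ≠ 0 := by
      have : redVec p (Pi.single l (1 : ℤ) : Fin k → ℤ) = Pi.single l 1 := by
        ext i; by_cases hi : i = l <;> simp [redVec, hi]
      rw [this]
      simpa using hl
    refine ⟨v + Pi.single l 1, Pi.single l 1, by simp, ?_, h1⟩
    rw [hadd, dotProduct_add, h, zero_add]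
    exact h1
  · refine ⟨v + v, v, by simp, ?_, h⟩
    rw [hadd, dotProduct_add, ← two_mul]
    exact mul_ne_zero h2 h

/-- The quotient `A₂ A₁⁻¹` equals `A₂ adj(Q) ᵗA₁ Q₁ / (p² det q)`. Modulo `p` all combinations of
rows of `A₁` and `A₂` are multiples of the same `b`, and their dual norms are divisible by `p²`; by
`dvd_of_parallel` so are the mixed products. The denominator `det q` is excluded because `det A₁ = ±
p³`. -/
theorem exists_factor_of_kerMod_eq (hd : formDet q₁ = formDet q) (hd' : formDet q₂ = formDet q)
    (h0 : formDet q ≠ 0) (hc : IsCoprime (p : ℤ) (formDet q))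
    (hA : A₁ ∈ PrimRep q₁ ((p : ℤ) ^ 2 • q)) (hA' : A₂ ∈ PrimRep q₂ ((p : ℤ) ^ 2 • q))
    (h : kerMod p A₁ = kerMod p A₂) : ∃ X, A₂ = X * A₁ := by
  have hp0 : (p : ℤ) ≠ 0 := prime_ne_zero
  have h2 := two_ne_zero_of_isCoprime hc
  obtain ⟨b, hb, -, hker⟩ := exists_row hd h0 hc hA
  obtain ⟨u, hu⟩ := exists_column hb (X := A₁) fun y hy => (hker y).mpr hy
  obtain ⟨w, hw⟩ := exists_column hb (X := A₂) fun y hy => h ▸ (hker y).mpr hy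
  have hne : ∀ {u : Fin 3 → ZMod p} {X : Matrix (Fin 3) (Fin 3) ℤ},
      (∀ v, redVec p (Xᵀ *ᵥ v) = (u ⬝ᵥ redVec p v) • b) → redMat p X ≠ 0 → u ≠ 0 := by
    rintro u X hX hX0 rfl
    apply hX0
    have h3 : redMat p Xᵀ = 0 := by
      rw [redMat_eq_zero]
      have h4 := exists_mul_eq_smul p (A := (1 : Matrix (Fin 3) (Fin 3) ℤ)) (B := Xᵀ) fun v => by
        rw [hX]; simp
      simpa using h4
    rw [redMat_transpose] at h3
    simpa using congrArg transpose h3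
  have hu0 := hne hu (redMat_ne_zero_of_mem_PrimRep hA)
  have hw0 := hne hw (redMat_ne_zero_of_mem_PrimRep hA')
  have hS : ((formMatrix q).adjugate)ᵀ = (formMatrix q).adjugate := by
    rw [adjugate_transpose, formMatrix_transpose]
  have hself : ∀ {r : IntForm 3} {X : Matrix (Fin 3) (Fin 3) ℤ}, formDet r = formDet q →
      X ∈ Rep r ((p : ℤ) ^ 2 • q) → ∀ v,
      (p : ℤ) ^ 2 ∣ (Xᵀ *ᵥ v) ⬝ᵥ (formMatrix q).adjugate *ᵥ (Xᵀ *ᵥ v) := by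
    intro r X hr hX v
    refine ⟨v ⬝ᵥ (formMatrix r).adjugate *ᵥ v, ?_⟩
    rw [mulVec_transpose, ← dotProduct_mulVec, ← mulVec_transpose, mulVec_mulVec, mulVec_mulVec,
      mul_adjugate_formMatrix_mul hr h0 hX, smul_mulVec, dotProduct_smul, smul_eq_mul]
  have hgood : ∀ v v', w ⬝ᵥ redVec p v ≠ 0 → u ⬝ᵥ redVec p v' ≠ 0 →
      (p : ℤ) ^ 2 ∣ (A₂ᵀ *ᵥ v) ⬝ᵥ (formMatrix q).adjugate *ᵥ (A₁ᵀ *ᵥ v') := fun v v' hv hv' =>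
    dvd_of_parallel hS h2 hv hv' (hw v) (hu v') (hself hd' hA'.1 v) (hself hd hA.1 v')
  have hall : ∀ v v',
      (p : ℤ) ^ 2 ∣ (A₂ᵀ *ᵥ v) ⬝ᵥ (formMatrix q).adjugate *ᵥ (A₁ᵀ *ᵥ v') := by
    intro v v'
    obtain ⟨v₁, v₂, rfl, g1, g2⟩ := exists_sub_of_functional h2 hw0 v
    obtain ⟨w₁, w₂, rfl, g3, g4⟩ := exists_sub_of_functional h2 hu0 v'
    simp only [mulVec_sub, sub_dotProduct, dotProduct_sub]
    exact dvd_sub (dvd_sub (hgood _ _ g1 g3) (hgood _ _ g2 g3))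
      (dvd_sub (hgood _ _ g1 g4) (hgood _ _ g2 g4))
  obtain ⟨X, hX⟩ : ∃ X, A₂ * (formMatrix q).adjugate * A₁ᵀ = (p : ℤ) ^ 2 • X := by
    have h3 : ∀ i j, (p : ℤ) ^ 2 ∣ (A₂ * (formMatrix q).adjugate * A₁ᵀ) i j := by
      intro i j
      have h4 := hall (Pi.single i 1) (Pi.single j 1)
      rw [mulVec_transpose, ← dotProduct_mulVec, mulVec_mulVec, mulVec_mulVec] at h4
      simpa using h4
    choose X hX using h3
    exact ⟨X, Matrix.ext hX⟩
  obtain ⟨ε, hε, hdet⟩ := exists_sign hd h0 hA.1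
  have e1 : X * formMatrix q₁ * A₁ = formDet q • A₂ := by
    apply smul_mat_cancel (pow_ne_zero 2 hp0)
    calc (p : ℤ) ^ 2 • (X * formMatrix q₁ * A₁)
        = A₂ * (formMatrix q).adjugate * (A₁ᵀ * formMatrix q₁ * A₁) := by
          rw [← Matrix.smul_mul, ← Matrix.smul_mul, ← hX]
          simp only [Matrix.mul_assoc]
      _ = (p : ℤ) ^ 2 • (formDet q • A₂) := by
          rw [formMatrix_of_mem_Rep hA.1, Matrix.mul_smul, Matrix.mul_assoc, adjugate_mul,
            Matrix.mul_smul, Matrix.mul_one]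
          rfl
  have e2 : formDet q • (A₂ * A₁.adjugate) = (p : ℤ) ^ 3 • (ε • (X * formMatrix q₁)) := by
    rw [← Matrix.smul_mul, ← e1, Matrix.mul_assoc, mul_adjugate, hdet, Matrix.mul_smul,
      Matrix.mul_one, smul_smul, mul_comm]
  obtain ⟨Z, hZ⟩ := exists_of_smul_eq_smul (IsCoprime.pow_left hc) e2
  refine ⟨ε • Z, smul_mat_cancel (pow_ne_zero 3 hp0) ?_⟩
  have h5 : A₂ * A₁.adjugate * A₁ = (ε * (p : ℤ) ^ 3) • A₂ := by
    rw [Matrix.mul_assoc, adjugate_mul, hdet, Matrix.mul_smul, Matrix.mul_one]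
  rw [hZ] at h5
  rw [Matrix.smul_mul, smul_comm, ← Matrix.smul_mul, h5, smul_smul, ← mul_assoc, hε, one_mul]

theorem exists_unit_of_kerMod_eq_ternary (hd : formDet q₁ = formDet q)
    (hd' : formDet q₂ = formDet q)
    (h0 : formDet q ≠ 0) (hc : IsCoprime (p : ℤ) (formDet q))
    (hA : A₁ ∈ PrimRep q₁ ((p : ℤ) ^ 2 • q)) (hA' : A₂ ∈ PrimRep q₂ ((p : ℤ) ^ 2 • q))
    (h : kerMod p A₁ = kerMod p A₂) :
    A₁.det ≠ 0 ∧
    ∃ U : Matrix.GeneralLinearGroup (Fin 3) ℤ, A₂ = (U : Matrix (Fin 3) (Fin 3) ℤ) * A₁ := by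
  have hdet : A₁.det ≠ 0 := by
    have := det_sq_of_mem_Rep hA.1 hd h0
    intro h5
    rw [h5] at this
    exact pow_ne_zero 3 (pow_ne_zero 2 prime_ne_zero) (this.symm.trans (by norm_num))
  obtain ⟨X, hX⟩ := exists_factor_of_kerMod_eq hd hd' h0 hc hA hA' h
  obtain ⟨Y, hY⟩ := exists_factor_of_kerMod_eq hd' hd h0 hc hA' hA h.symm
  exact ⟨hdet, exists_unit_of_left_factors hdet hX hY⟩

end Ternary

/-! ### Neighbours of a ternary lattice -/

/-- The matrix whose columns are the basis `v, p² e_i, p (e_j + c e_i)` of `p` times a neighbour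
of `ℤ³`. -/
def neighbourBasis (p c : ℤ) (v : Fin 3 → ℤ) (i j k : Fin 3) : Matrix (Fin 3) (Fin 3) ℤ :=
  Matrix.of fun r s => if s = k then v r else if s = i then (if r = i then p ^ 2 else 0)
    else (if r = j then p else if r = i then p * c else 0)

/-- The matrix of `p²` times the coordinate functionals of `neighbourBasis`. -/
def neighbourDual (p c : ℤ) (v : Fin 3 → ℤ) (i j k : Fin 3) : Matrix (Fin 3) (Fin 3) ℤ :=
  Matrix.of fun r s => if r = k then (if s = k then p ^ 2 else 0)
    else if r = j then (if s = j then p else if s = k then -(p * v j) else 0)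
    else (if s = i then 1 else if s = j then -c else c * v j - v i)

section Neighbour

variable {p c : ℤ} {v : Fin 3 → ℤ} {i j k : Fin 3}

theorem neighbourDual_mul_neighbourBasis (hij : i ≠ j) (hik : i ≠ k) (hjk : j ≠ k) (hv : v k = 1) :
    neighbourDual p c v i j k * neighbourBasis p c v i j k = p ^ 2 • 1 := by
  fin_cases i <;> fin_cases j <;> fin_cases k <;> simp at hij hik hjk hv <;>
  · ext r s
    fin_cases r <;> fin_cases s <;>
    simp [neighbourDual, neighbourBasis, Matrix.mul_apply, Fin.sum_univ_three, hv] <;> try ring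

theorem neighbourBasis_mul_neighbourDual (hij : i ≠ j) (hik : i ≠ k) (hjk : j ≠ k) (hv : v k = 1) :
    neighbourBasis p c v i j k * neighbourDual p c v i j k = p ^ 2 • 1 := by
  fin_cases i <;> fin_cases j <;> fin_cases k <;> simp at hij hik hjk hv <;>
  · ext r s
    fin_cases r <;> fin_cases s <;>
    simp [neighbourDual, neighbourBasis, Matrix.mul_apply, Fin.sum_univ_three, hv] <;> try ring

theorem neighbourBasis_det_sq (hij : i ≠ j) (hik : i ≠ k) (hjk : j ≠ k) (hv : v k = 1) :
    (neighbourBasis p c v i j k).det ^ 2 = p ^ 6 := by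
  fin_cases i <;> fin_cases j <;> fin_cases k <;> simp at hij hik hjk hv <;>
  · simp [neighbourBasis, det_fin_three, hv]
    try ring

theorem neighbourDual_mulVec (hij : i ≠ j) (hik : i ≠ k) (hjk : j ≠ k) (y : Fin 3 → ℤ) :
    neighbourDual p c v i j k *ᵥ y = fun r => if r = k then p * (p * y k)
      else if r = j then p * (y j - v j * y k) else y i - c * y j + (c * v j - v i) * y k := by
  fin_cases i <;> fin_cases j <;> fin_cases k <;> simp at hij hik hjk <;>
  · ext r
    fin_cases r <;> simp [neighbourDual, mulVec, dotProduct, Fin.sum_univ_three] <;> try ring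

theorem neighbourBasis_mulVec (hij : i ≠ j) (hik : i ≠ k) (hjk : j ≠ k) (x : Fin 3 → ℤ) :
    neighbourBasis p c v i j k *ᵥ x =
      x k • v + p • ((p * x i + c * x j) • Pi.single i 1 + x j • Pi.single j 1) := by
  fin_cases i <;> fin_cases j <;> fin_cases k <;> simp at hij hik hjk <;>
  · ext r
    fin_cases r <;> simp [neighbourBasis, mulVec, dotProduct, Fin.sum_univ_three] <;> try ring

theorem dotProduct_of_distinct {R : Type*} [CommRing R] (hij : i ≠ j) (hik : i ≠ k) (hjk : j ≠ k)
    (x y : Fin 3 → R) : x ⬝ᵥ y = x i * y i + x j * y j + x k * y k := by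
  fin_cases i <;> fin_cases j <;> fin_cases k <;> simp at hij hik hjk <;>
  · simp [dotProduct, Fin.sum_univ_three]; try ring

end Neighbour

/-! ### Tangent planes realised by neighbours -/

section Existence

variable {p : ℕ} [hp : Fact p.Prime] {q : IntForm 3}

/-- The neighbour of `ℤ³` with respect to a vector `v` with `q(v) ≡ 0` modulo `p²`. -/
theorem exists_PrimRep_of_vector (hc : IsCoprime (p : ℤ) (formDet q)) {v : Fin 3 → ℤ}
    {i k : Fin 3} (hik : i ≠ k) (hv : v k = 1) (hqv : (p : ℤ) ^ 2 ∣ q v)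
    (hi : ((formMatrix q *ᵥ v) i : ZMod p) ≠ 0) :
    ∃ (q' : IntForm 3) (A : Matrix (Fin 3) (Fin 3) ℤ), Similar q q' ∧
      A ∈ PrimRep q' ((p : ℤ) ^ 2 • q) ∧
      kerMod p A = tangentPlane (redMat p (formMatrix q)) (redVec p v) := by
  have hp0 : (p : ℤ) ≠ 0 := prime_ne_zero
  obtain ⟨j, hij, hjk⟩ : ∃ j : Fin 3, i ≠ j ∧ j ≠ k := by
    clear hv hi
    revert i k
    decide
  set b := formMatrix q *ᵥ v with hb
  -- This `c` makes `e_j + c e_i` orthogonal to `v` modulo `p`.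
  obtain ⟨c, hcc⟩ := ZMod.intCast_surjective (n := p) (-(b j : ZMod p) / (b i : ZMod p))
  have hbj : (p : ℤ) ∣ b j + c * b i := by
    rw [← ZMod.intCast_zmod_eq_zero_iff_dvd]
    push_cast
    rw [hcc]
    field_simp
    ring
  -- Solved from `v · b = 2 q(v) ≡ 0` with `v k = 1`.
  have hbk : ((b k : ℤ) : ZMod p) = -(b i : ZMod p) * v i - b j * v j := by
    have h1 := two_mul_apply q v
    rw [← hb, dotProduct_of_distinct hij hik hjk, hv] at h1
    obtain ⟨s, hs⟩ := hqv
    have h2 := congrArg (Int.cast : ℤ → ZMod p) h1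
    rw [hs] at h2
    push_cast at h2
    simp only [CharP.cast_eq_zero] at h2
    linear_combination -h2
  set B := neighbourBasis p c v i j k
  set A := neighbourDual p c v i j k
  have hAB : A * B = (p : ℤ) ^ 2 • 1 := neighbourDual_mul_neighbourBasis hij hik hjk hv
  have hBA : B * A = (p : ℤ) ^ 2 • 1 := neighbourBasis_mul_neighbourDual hij hik hjk hv
  have hdvd : ∀ x, (p : ℤ) ^ 2 ∣ subst q B x := by
    intro x
    have h1 : subst q B x = q (x k • v + (p : ℤ) • ((p * x i + c * x j) • Pi.single i 1 +
        x j • Pi.single j 1)) := by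
      rw [← neighbourBasis_mulVec hij hik hjk]; rfl
    set g : Fin 3 → ℤ := (p * x i + c * x j) • Pi.single i 1 + x j • Pi.single j 1 with hg
    have h2 : QuadraticMap.polar q v g = p * (x i * b i) + x j * (b j + c * b i) := by
      rw [polar_eq_dotProduct, dotProduct_mulVec_symm (formMatrix_transpose q), ← hb, hg]
      simp only [add_dotProduct, smul_dotProduct, single_dotProduct, smul_eq_mul, one_mul]
      ring
    -- In `q(x_k v + p g)` the first two terms are divisible by `p²` at once; the mixed one is too,
    -- since the polar value of `v` and `g` is divisible by `p`.
    have h3 : subst q B x = x k * x k * q v + p * p * q g +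
        x k * (p * QuadraticMap.polar q v g) := by
      rw [h1, QuadraticMap.map_add q, QuadraticMap.map_smul, QuadraticMap.map_smul,
        QuadraticMap.polar_smul_left, QuadraticMap.polar_smul_right]
      simp only [smul_eq_mul]
    rw [h3, h2]
    obtain ⟨s, hs⟩ := hqv
    obtain ⟨t, ht⟩ := hbj
    rw [hs, ht]
    exact ⟨x k * x k * s + q g + x k * (x i * b i + x j * t), by ring⟩
  obtain ⟨q', hq'⟩ := exists_form_of_dvd (pow_ne_zero 2 hp0) _ hdvd
  have hB : B ∈ Rep q ((p : ℤ) ^ 2 • q') := hq'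
  refine ⟨q', A, ⟨?_, (p : ℤ) ^ 2, pow_ne_zero 2 hp0, IsCoprime.pow_left hc, B, hB⟩,
    ⟨mem_Rep_of_mul_eq (pow_ne_zero 2 hp0) hB hBA, ?_⟩, ?_⟩
  · have h3 := congrArg Matrix.det (formMatrix_of_mem_Rep hB)
    rw [det_mul, det_mul, det_transpose, det_smul, Fintype.card_fin] at h3
    have h4 : B.det ^ 2 = (p : ℤ) ^ 6 := neighbourBasis_det_sq hij hik hjk hv
    apply mul_left_cancel₀ (pow_ne_zero 6 hp0)
    unfold formDet
    linear_combination h3 - (formMatrix q).det * h4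
  · intro d hd
    have h5 : A i i = 1 := by simp [A, neighbourDual, hij, hik]
    exact isUnit_of_dvd_one (h5 ▸ hd i i)
  · ext y
    obtain ⟨y, rfl⟩ := redVec_surjective p y
    have hs : (redMat p (formMatrix q))ᵀ = redMat p (formMatrix q) := by
      rw [← redMat_transpose, formMatrix_transpose]
    -- Modulo `p` only row `i` of `A` survives, and `b i` times that row is the functional
    -- orthogonal to `v`.
    have h6 : redVec p v ⬝ᵥ redMat p (formMatrix q) *ᵥ redVec p y =
        b i * (y i - c * y j + (c * v j - v i) * y k : ℤ) := by
      rw [dotProduct_mulVec_symm hs, ← redVec_mulVec, redVec_dotProduct, ← hb,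
        dotProduct_of_distinct hij hik hjk]
      have h7 := (ZMod.intCast_zmod_eq_zero_iff_dvd _ _).mpr hbj
      push_cast at h7 ⊢
      rw [hbk]
      linear_combination ((y j : ZMod p) - v j * y k) * h7
    rw [mem_tangentPlane, h6, mul_eq_zero, or_iff_right hi, mem_kerMod, ← redVec_mulVec,
      neighbourDual_mulVec hij hik hjk]
    constructor
    · intro h
      simpa [redVec, hij, hik] using congrFun h i
    · intro h
      ext r
      simp only [redVec, Pi.zero_apply]
      split_ifs
      · simp
      · simp
      · exact h

theorem tangentPlane_smul {F : Type*} [Field F] (Q : Matrix (Fin 3) (Fin 3) F) (v : Fin 3 → F)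
    {c : F} (hc : c ≠ 0) : tangentPlane Q (c • v) = tangentPlane Q v := by
  ext y
  rw [mem_tangentPlane, mem_tangentPlane, smul_dotProduct, smul_eq_zero, or_iff_right hc]

/-- A Hensel step: the contact point, scaled to have `k`-th coordinate one, is lifted to `v` over
`ℤ` and corrected by a multiple of `p e_i` until `p²` divides `q(v)`. The choice `i ≠ k` keeps the
normalisation. -/
theorem exists_PrimRep_of_isTangent (hc : IsCoprime (p : ℤ) (formDet q))
    {K : Submodule (ZMod p) (Fin 3 → ZMod p)} (hK : IsTangent (redMat p (formMatrix q)) K) :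
    ∃ (q' : IntForm 3) (A : Matrix (Fin 3) (Fin 3) ℤ), Similar q q' ∧
      A ∈ PrimRep q' ((p : ℤ) ^ 2 • q) ∧ kerMod p A = K := by
  have h2 := two_ne_zero_of_isCoprime hc
  obtain ⟨w, hw, hww, rfl⟩ := hK
  obtain ⟨k, hk⟩ := Function.ne_iff.mp hw
  simp only [Pi.zero_apply] at hk
  obtain ⟨v, hv, hvw⟩ : ∃ v : Fin 3 → ℤ, v k = 1 ∧ redVec p v = (w k)⁻¹ • w := by
    obtain ⟨v, hv⟩ := redVec_surjective p ((w k)⁻¹ • w)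
    refine ⟨Function.update v k 1, by simp, ?_⟩
    rw [← hv]
    ext r
    by_cases hr : r = k
    · subst hr
      have := congrFun hv r
      simp only [redVec, Pi.smul_apply, smul_eq_mul, inv_mul_cancel₀ hk] at this
      simp [redVec, this]
    · simp [redVec, hr]
  rw [← tangentPlane_smul _ w (inv_ne_zero hk), ← hvw]
  have hiso : redVec p v ⬝ᵥ redMat p (formMatrix q) *ᵥ redVec p v = 0 := by
    rw [hvw, mulVec_smul, smul_dotProduct, dotProduct_smul, hww, smul_zero, smul_zero]
  have hb0 : redMat p (formMatrix q) *ᵥ redVec p v ≠ 0 := by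
    intro h
    apply smul_ne_zero (inv_ne_zero hk) hw
    rw [← hvw]
    refine Matrix.eq_zero_of_mulVec_eq_zero ?_ h
    rw [redMat_det]; exact cast_ne_zero_of_isCoprime hc
  rw [← redVec_mulVec] at hb0 hiso
  -- If `Q v` vanished at all places except `k`, then `v · Q v = 0` and `v k = 1` would make it
  -- vanish at `k` as well.
  obtain ⟨i, hik, hi⟩ : ∃ i, i ≠ k ∧ ((formMatrix q *ᵥ v) i : ZMod p) ≠ 0 := by
    by_contra! h
    apply hb0
    ext r
    by_cases hr : r = k
    · subst hr
      rw [dotProduct, Finset.sum_eq_single r] at hiso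
      · simpa [redVec, hv] using hiso
      · intro s _ hs
        simp [redVec, h s hs]
      · simp
    · exact h r hr
  obtain ⟨s, hs⟩ : (p : ℤ) ∣ q v := by
    rw [redVec_dotProduct, ← two_mul_apply] at hiso
    push_cast at hiso
    exact (ZMod.intCast_zmod_eq_zero_iff_dvd _ _).mp ((mul_eq_zero.mp hiso).resolve_left h2)
  -- With `q(v) = p s`, adding `p c e_i` to `v` changes `q(v) / p` by `c (Q v)_i` modulo `p`.
  obtain ⟨c, hcc⟩ := ZMod.intCast_surjective (n := p)
    (-(s : ZMod p) / ((formMatrix q *ᵥ v) i : ZMod p))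
  have hdvd : (p : ℤ) ∣ s + c * (formMatrix q *ᵥ v) i := by
    rw [← ZMod.intCast_zmod_eq_zero_iff_dvd]
    push_cast
    rw [hcc]
    field_simp
    ring
  set v' : Fin 3 → ℤ := v + (p * c) • Pi.single i 1 with hv'
  have hred : redVec p v' = redVec p v := by
    ext r; simp [redVec, hv']
  rw [← hred]
  refine exists_PrimRep_of_vector hc hik ?_ ?_ ?_
  · simp [hv', hv, hik.symm]
  · have h1 : QuadraticMap.polar q v (Pi.single i 1) = (formMatrix q *ᵥ v) i := by
      rw [polar_eq_dotProduct, dotProduct_mulVec_symm (formMatrix_transpose q)]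
      simp
    obtain ⟨t, ht⟩ := hdvd
    rw [hv', QuadraticMap.map_add q, QuadraticMap.map_smul, QuadraticMap.polar_smul_right, h1, hs]
    refine ⟨t + c * c * q (Pi.single i 1), ?_⟩
    simp only [smul_eq_mul]
    linear_combination (p : ℤ) * ht
  · have h3 := congrFun (redVec_mulVec p (formMatrix q) v') i
    have h4 := congrFun (redVec_mulVec p (formMatrix q) v) i
    rw [hred, ← h4] at h3
    exact fun h => hi (h3.symm.trans h)

end Existence

/-! ### Divisors of the lift -/

section Divisors

variable {p : ℕ} [hp : Fact p.Prime] {q q₁ : IntForm 3} {A : Matrix (Fin 3) (Fin 3) ℤ}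

theorem mulVec_eq_head_add {n : ℕ} (X : Matrix (Fin n) (Fin 4) ℤ) (x : Fin 4 → ℤ) (r : Fin n) :
    (X *ᵥ x) r = X r 0 * x 0 + ∑ j : Fin 3, X r j.succ * imPart x j := by
  rw [mulVec, dotProduct, Fin.sum_univ_succ]
  rfl

/-- When the last three coordinates vanish modulo `p`, the norm form reduces to `x₀²`. This recovers
the head coordinate of a lift without computing the first row of its matrix. -/
theorem dvd_head_of_dvd_normForm (h2 : (2 : ZMod p) ≠ 0) (q : IntForm 3) {x : Fin 4 → ℤ}
    {y : Fin 3 → ℤ} (hx : imPart x = (p : ℤ) • y) (hn : (p : ℤ) ∣ normForm q x) :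
    (p : ℤ) ∣ x 0 := by
  have h := congrArg (Int.cast : ℤ → ZMod p) (four_mul_normForm q x)
  rw [hx, mulVec_smul, dotProduct_smul, smul_dotProduct] at h
  have hn' := (ZMod.intCast_zmod_eq_zero_iff_dvd _ p).mpr hn
  simp only [smul_eq_mul] at h
  push_cast at h
  rw [hn'] at h
  simp only [CharP.cast_eq_zero, zero_mul, add_zero, mul_zero] at h
  rw [← ZMod.intCast_zmod_eq_zero_iff_dvd]
  have h3 : (2 * (x 0 : ZMod p)) = 0 := by simpa using h.symm
  exact (mul_eq_zero.mp h3).resolve_left h2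

/-- The cofactor matrix of an automorph with multiplier `p²` is divisible by `p`. -/
theorem exists_cofactor (hd : formDet q₁ = formDet q) (h0 : formDet q ≠ 0)
    (hc : IsCoprime (p : ℤ) (formDet q)) (hA : A ∈ Rep q₁ ((p : ℤ) ^ 2 • q)) :
    ∃ L : Matrix (Fin 3) (Fin 3) ℤ, A.adjugateᵀ = (p : ℤ) • L ∧ ∀ y, redVec p (L *ᵥ y) = 0 ↔
      redMat p A *ᵥ ((redMat p (formMatrix q)).adjugate *ᵥ redVec p y) = 0 := by
  have hp0 : (p : ℤ) ≠ 0 := prime_ne_zero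
  obtain ⟨ε, hε, hdet⟩ := exists_sign hd h0 hA
  -- Multiply `ᵗA Q₁ A = p² Q` by the transposed adjugate of `A` on the left and by `adj Q` on the
  -- right; `det A = ± p³` leaves one factor `p` after cancellation.
  have h1 : formDet q • A.adjugateᵀ =
      (p : ℤ) • (ε • (formMatrix q₁ * A * (formMatrix q).adjugate)) := by
    have h3 := congrArg (fun X => A.adjugateᵀ * X * (formMatrix q).adjugate)
      (formMatrix_of_mem_Rep hA)
    have h4 : A.adjugateᵀ * (Aᵀ * formMatrix q₁ * A) * (formMatrix q).adjugate =
        A.det • (formMatrix q₁ * A * (formMatrix q).adjugate) := by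
      rw [Matrix.mul_assoc Aᵀ, ← Matrix.mul_assoc _ Aᵀ, ← transpose_mul, mul_adjugate,
        transpose_smul, transpose_one, Matrix.smul_mul, Matrix.one_mul, Matrix.smul_mul]
    simp only [h4, Matrix.mul_smul, Matrix.smul_mul] at h3
    rw [Matrix.mul_assoc A.adjugateᵀ, mul_adjugate, Matrix.mul_smul, Matrix.mul_one] at h3
    apply smul_mat_cancel (pow_ne_zero 2 hp0)
    rw [formDet, ← h3, hdet, smul_smul, smul_smul]
    congr 1
    ring
  obtain ⟨L, hL⟩ := exists_of_smul_eq_smul hc h1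
  refine ⟨L, hL, fun y => ?_⟩
  have h5 : formDet q • L = ε • (formMatrix q₁ * A * (formMatrix q).adjugate) := by
    apply smul_mat_cancel hp0
    rw [← h1, hL, smul_comm]
  have h6 := congrArg (fun X => redMat p X *ᵥ redVec p y) h5
  simp only [redMat_smul, smul_mulVec, redMat_mul, ← mulVec_mulVec, redMat_adjugate] at h6
  have hD := cast_ne_zero_of_isCoprime hc
  have hε0 : (ε : ZMod p) ≠ 0 := by
    intro h
    have := congrArg (Int.cast : ℤ → ZMod p) hε
    push_cast at this
    rw [h] at this
    simp at this
  have hQ : (redMat p (formMatrix q₁)).det ≠ 0 := by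
    rw [redMat_det]
    exact cast_ne_zero_of_isCoprime (show IsCoprime (p : ℤ) (formDet q₁) from hd ▸ hc)
  rw [redVec_mulVec]
  constructor
  · intro h
    rw [h, smul_zero] at h6
    exact Matrix.eq_zero_of_mulVec_eq_zero hQ ((smul_eq_zero.mp h6.symm).resolve_left hε0)
  · intro h
    rw [h, mulVec_zero, smul_zero] at h6
    exact (smul_eq_zero.mp h6).resolve_left hD

/-- The lift is integral, and its kernel modulo `p` is determined by the kernel of the automorph. -/
theorem exists_integral_lift (hd : formDet q₁ = formDet q) (h0 : formDet q ≠ 0)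
    (hc : IsCoprime (p : ℤ) (formDet q)) (hA : A ∈ Rep q₁ ((p : ℤ) ^ 2 • q)) :
    ∃ P : Matrix (Fin 4) (Fin 4) ℤ, P.map (Int.cast : ℤ → ℚ) = liftPsi p hA ∧
      ∀ x, redVec p x ∈ kerMod p P ↔
        redMat p A *ᵥ ((redMat p (formMatrix q)).adjugate *ᵥ redVec p (imPart x)) = 0 := by
  have hp0 : (p : ℤ) ≠ 0 := prime_ne_zero
  have h2 := two_ne_zero_of_isCoprime hc
  obtain ⟨L, hL, hker⟩ := exists_cofactor hd h0 hc hA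
  have hsucc : ∀ i j : Fin 3, liftPhi hA i.succ j.succ = p * L i j := fun i j => by
    rw [liftPhi_succ_succ]
    exact congrFun (congrFun hL i) j
  -- The cofactor block is divisible by `p`. Each of these columns also has norm divisible by `p`,
  -- which forces its head entry to be divisible.
  have hdvd : ∀ (r : Fin 4) (j : Fin 3), (p : ℤ) ∣ liftPhi hA r j.succ := by
    intro r j
    refine Fin.cases ?_ (fun i => ⟨L i j, hsucc i j⟩) r
    have h3 := normForm_liftPhi hA (Pi.single j.succ 1)
    rw [mulVec_single_one, normForm_smul] at h3
    refine dvd_head_of_dvd_normForm h2 q₁ (x := (liftPhi hA).col j.succ) (y := fun i => L i j)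
      (funext fun i => hsucc i j) ?_
    have h4 : ∀ e : Fin 4 → ℤ, e 0 = 0 → ![e 0, (p : ℤ) ^ 2 * e 1, (p : ℤ) ^ 2 * e 2,
        (p : ℤ) ^ 2 * e 3] = (p : ℤ) ^ 2 • e := by
      intro e he
      ext r
      fin_cases r <;> simp [he]
    rw [h3, h4 _ (by simp), QuadraticMap.map_smul]
    exact ⟨p * p * p * normForm q (Pi.single j.succ 1), by rw [smul_eq_mul]; ring⟩
  choose C hC using hdvd
  let P : Matrix (Fin 4) (Fin 4) ℤ :=
    Matrix.of fun r => vecCons (p * (Pi.single 0 1 : Fin 4 → ℤ) r) (C r)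
  have hP : ∀ x r, (P *ᵥ x) r =
      p * (Pi.single 0 1 : Fin 4 → ℤ) r * x 0 + ∑ j : Fin 3, C r j * imPart x j := fun x r =>
    mulVec_eq_head_add P x r
  have him : ∀ x, imPart (P *ᵥ x) = L *ᵥ imPart x := by
    intro x
    ext i
    have h3 : ∀ j, C i.succ j = L i j := fun j =>
      mul_left_cancel₀ hp0 ((hC _ _).symm.trans (hsucc i j))
    change (P *ᵥ x) i.succ = (L *ᵥ imPart x) i
    rw [hP]
    simp [h3, mulVec, dotProduct]
  -- `p P` is the matrix of the even map after scaling the head coordinate by `p²`, so it multiplies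
  -- norms by `p⁴`, and `P` by `p²`.
  have hnorm : ∀ x, normForm q₁ (P *ᵥ x) = (p : ℤ) ^ 2 * normForm q x := by
    intro x
    have h3 : (p : ℤ) • (P *ᵥ x) = liftPhi hA *ᵥ vecCons ((p : ℤ) ^ 2 * x 0) (imPart x) := by
      ext r
      rw [Pi.smul_apply, hP, mulVec_eq_head_add, liftPhi_col_zero]
      simp only [cons_val_zero, hC, smul_eq_mul, mul_add, Finset.mul_sum]
      congr 1
      · ring
      · refine Finset.sum_congr rfl fun j _ => ?_
        rw [← mul_assoc]
        rfl
    have h4 := congrArg (normForm q₁) h3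
    have h5 : (![vecCons ((p : ℤ) ^ 2 * x 0) (imPart x) 0,
        (p : ℤ) ^ 2 * vecCons ((p : ℤ) ^ 2 * x 0) (imPart x) 1,
        (p : ℤ) ^ 2 * vecCons ((p : ℤ) ^ 2 * x 0) (imPart x) 2,
        (p : ℤ) ^ 2 * vecCons ((p : ℤ) ^ 2 * x 0) (imPart x) 3] : Fin 4 → ℤ) =
        (p : ℤ) ^ 2 • x := by
      ext r
      fin_cases r <;> rfl
    rw [normForm_liftPhi, normForm_smul, h5, QuadraticMap.map_smul, QuadraticMap.map_smul,
      smul_eq_mul, smul_eq_mul] at h4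
    apply mul_left_cancel₀ (mul_ne_zero hp0 hp0)
    rw [h4]; ring
  refine ⟨P, ?_, fun x => ?_⟩
  · ext r s
    rw [liftPsi, Matrix.mul_diagonal, Matrix.map_apply, Matrix.map_apply]
    refine Fin.cases ?_ (fun j => ?_) s
    · rw [liftPhi_col_zero]
      change ((p * (Pi.single 0 1 : Fin 4 → ℤ) r : ℤ) : ℚ) = _ * (p : ℚ)
      push_cast
      ring
    · have hpq : (p : ℚ) ≠ 0 := by exact_mod_cast hp.out.ne_zero
      have h6 : (![(p : ℚ), (p : ℚ)⁻¹, (p : ℚ)⁻¹, (p : ℚ)⁻¹] : Fin 4 → ℚ) j.succ = (p : ℚ)⁻¹ := by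
        fin_cases j <;> rfl
      rw [h6, hC]
      change ((C r j : ℤ) : ℚ) = _
      push_cast
      field_simp
  -- The last three coordinates of `P x` are `L x'`. If they vanish modulo `p`, so does the head,
  -- because the norm of `P x` is divisible by `p`.
  · rw [← hker, mem_kerMod, ← redVec_mulVec, ← him]
    constructor
    · intro h
      exact funext fun i => congrFun h i.succ
    · intro h
      obtain ⟨y, hy⟩ := (redVec_eq_zero p _).mp h
      have h7 := dvd_head_of_dvd_normForm h2 q₁ hy
        (by rw [hnorm, sq, mul_assoc]; exact dvd_mul_right _ _)
      ext r
      exact Fin.cases ((ZMod.intCast_zmod_eq_zero_iff_dvd _ p).mpr h7) (fun i => congrFun h i) r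

/-- Integrality of `P M⁻¹` means `P = X M`, and since `p M⁻¹` is integral, such a factorisation is
detected by the kernels modulo `p`. -/
theorem rightDivides_iff_of_integral {M M' P : Matrix (Fin 4) (Fin 4) ℤ}
    {Ψ : Matrix (Fin 4) (Fin 4) ℚ} (hP : P.map (Int.cast : ℤ → ℚ) = Ψ)
    (h1 : M * M' = (p : ℤ) • 1) (h2 : M' * M = (p : ℤ) • 1) :
    RightDivides M Ψ ↔ kerMod p M ≤ kerMod p P := by
  have hmap : ∀ X Y : Matrix (Fin 4) (Fin 4) ℤ, (X * Y).map (Int.cast : ℤ → ℚ) =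
      X.map (Int.cast : ℤ → ℚ) * Y.map (Int.cast : ℤ → ℚ) := fun X Y =>
    Matrix.map_mul (f := Int.castRingHom ℚ)
  have hdet : IsUnit (M.map (Int.cast : ℤ → ℚ)).det := by
    have h3 := congrArg Matrix.det h1
    rw [det_mul, det_smul, det_one, mul_one] at h3
    have h4 : M.det ≠ 0 := fun h => by
      rw [h, zero_mul] at h3
      exact pow_ne_zero _ prime_ne_zero h3.symm
    have h5 : (M.map (Int.cast : ℤ → ℚ)).det = (M.det : ℚ) :=
      ((Int.castRingHom ℚ).map_det M).symm
    rw [h5, isUnit_iff_ne_zero]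
    exact_mod_cast h4
  subst hP
  constructor
  · rintro ⟨X, hX⟩
    have h3 : P = X * M := by
      apply Matrix.map_injective (Int.cast_injective (α := ℚ))
      simp only [hmap, ← hX]
      rw [Matrix.mul_assoc, Matrix.nonsing_inv_mul _ hdet, Matrix.mul_one]
    rw [h3]
    exact kerMod_le_of_mul p X M
  · intro h
    obtain ⟨X, hX⟩ := kernel_le_factor h1 h2 h
    refine ⟨X, ?_⟩
    rw [hX, hmap, Matrix.mul_assoc, Matrix.mul_nonsing_inv _ hdet, Matrix.mul_one]

/-! ### Coordinates in which the norm form is `z² + det Q · Q[y]` -/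

/-- The coordinates `z = 2 x₀ + t x'`, `y = Q⁻¹ x'`. -/
def coordMap {F : Type*} [Field F] (Q : Matrix (Fin 3) (Fin 3) F) :
    (Fin 4 → F) →ₗ[F] F × (Fin 3 → F) where
  toFun x := (2 * x 0 + traceVec Q ⬝ᵥ imPart x, Q.det⁻¹ • Q.adjugate *ᵥ imPart x)
  map_add' x y := by
    have h : imPart (x + y) = imPart x + imPart y := rfl
    rw [h, dotProduct_add, mulVec_add, smul_add, Pi.add_apply, Prod.mk_add_mk]
    congr 1
    ring
  map_smul' c x := by
    have h : imPart (c • x) = c • imPart x := rfl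
    rw [h, dotProduct_smul, mulVec_smul, Pi.smul_apply, RingHom.id_apply, Prod.smul_mk,
      smul_comm c, smul_add, smul_eq_mul, smul_eq_mul]
    congr 1
    simp only [smul_eq_mul]
    ring

theorem coordMap_injective {F : Type*} [Field F] {Q : Matrix (Fin 3) (Fin 3) F}
    (h2 : (2 : F) ≠ 0) (hd : Q.det ≠ 0) : Function.Injective (coordMap Q) := by
  rw [← LinearMap.ker_eq_bot, LinearMap.ker_eq_bot']
  intro x hx
  have h3 : Q.adjugate *ᵥ imPart x = 0 :=
    (smul_eq_zero.mp (congrArg Prod.snd hx)).resolve_left (inv_ne_zero hd)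
  have h4 : imPart x = 0 := Matrix.eq_zero_of_mulVec_eq_zero
    (by rw [det_adjugate]; exact pow_ne_zero _ hd) h3
  have h5 : 2 * x 0 + traceVec Q ⬝ᵥ imPart x = 0 := congrArg Prod.fst hx
  rw [h4, dotProduct_zero, add_zero] at h5
  ext r
  exact Fin.cases ((mul_eq_zero.mp h5).resolve_left h2) (fun i => congrFun h4 i) r

/-- The coordinate change as a linear equivalence. -/
noncomputable def coordEquiv {F : Type*} [Field F] {Q : Matrix (Fin 3) (Fin 3) F} (h2 : (2 : F) ≠ 0)
    (hd : Q.det ≠ 0) : (Fin 4 → F) ≃ₗ[F] F × (Fin 3 → F) :=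
  LinearMap.linearEquivOfInjective (coordMap Q) (coordMap_injective h2 hd) (by simp)

/-- Substituting `y = Q⁻¹ x'` turns the adjoint form into `det Q · Q[y]`. It also turns the kernel
condition `A adj(Q) x' = 0` of the lift into `A y = 0`. -/
theorem extForm_coordMap {F : Type*} [Field F] {Q : Matrix (Fin 3) (Fin 3) F} (hd : Q.det ≠ 0)
    (x : Fin 4 → F) : extForm Q (coordMap Q x) =
      (2 * x 0 + traceVec Q ⬝ᵥ imPart x) ^ 2 + imPart x ⬝ᵥ Q.adjugate *ᵥ imPart x := by
  change (2 * x 0 + traceVec Q ⬝ᵥ imPart x) ^ 2 + Q.det * ((Q.det⁻¹ • Q.adjugate *ᵥ imPart x) ⬝ᵥ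
    Q *ᵥ (Q.det⁻¹ • Q.adjugate *ᵥ imPart x)) = _
  rw [mulVec_smul, mulVec_mulVec, mul_adjugate, smul_mulVec, one_mulVec, smul_dotProduct,
    dotProduct_smul, dotProduct_smul, dotProduct_comm (Q.adjugate *ᵥ imPart x)]
  simp only [smul_eq_mul]
  field_simp

theorem extForm_coordMap_redVec (hc : IsCoprime (p : ℤ) (formDet q)) (x : Fin 4 → ℤ) :
    extForm (redMat p (formMatrix q)) (coordMap (redMat p (formMatrix q)) (redVec p x)) =
      ((4 * normForm q x : ℤ) : ZMod p) := by
  have hd : (redMat p (formMatrix q)).det ≠ 0 := by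
    rw [redMat_det]; exact cast_ne_zero_of_isCoprime hc
  have h1 : imPart (redVec p x) = redVec p (imPart x) := rfl
  have h2 : traceVec (redMat p (formMatrix q)) = redVec p (traceVec (formMatrix q)) := by
    ext i
    fin_cases i <;> simp [traceVec, redVec, redMat]
  rw [extForm_coordMap hd, four_mul_normForm, h1, h2, ← redMat_adjugate, ← redVec_mulVec,
    redVec_dotProduct, redVec_dotProduct]
  simp [redVec]

end Divisors

/-! ### Invariants of the classes -/

section Classes

variable {p : ℕ} {q : IntForm 3}

theorem redMat_formMatrix_transpose {m : ℕ} (r : IntForm m) :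
    (redMat p (formMatrix r))ᵀ = redMat p (formMatrix r) := by
  rw [← redMat_transpose, formMatrix_transpose]

theorem isCoprime_formDet_normForm (hc : IsCoprime (p : ℤ) (formDet q)) :
    IsCoprime (p : ℤ) (formDet (normForm q)) := by
  have h : IsCoprime (p : ℤ) (4 * formDet (normForm q)) := by
    rw [four_mul_formDet_normForm]; exact hc.pow_right
  exact h.of_mul_right_right

theorem formDet_normForm_ne_zero (h0 : formDet q ≠ 0) : formDet (normForm q) ≠ 0 := by
  intro h
  have h1 := four_mul_formDet_normForm q
  rw [h, mul_zero] at h1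
  exact pow_ne_zero 2 h0 h1.symm

variable [hp : Fact p.Prime]

theorem det_redMat_formMatrix_ne_zero {m : ℕ} {r : IntForm m}
    (hc : IsCoprime (p : ℤ) (formDet r)) : (redMat p (formMatrix r)).det ≠ 0 := by
  rw [redMat_det]; exact cast_ne_zero_of_isCoprime hc

theorem isSingularPlane_map_kerMod (h0 : formDet q ≠ 0) (hc : IsCoprime (p : ℤ) (formDet q))
    {n₁ : IntForm 4} {M : Matrix (Fin 4) (Fin 4) ℤ} (hd : formDet n₁ = formDet (normForm q))
    (hM : M ∈ Rep n₁ ((p : ℤ) • normForm q)) :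
    IsSingularPlane (redMat p (formMatrix q))
      ((kerMod p M).map (coordMap (redMat p (formMatrix q)))) := by
  have h2 := two_ne_zero_of_isCoprime hc
  constructor
  · refine (LinearEquiv.finrank_map_eq (coordEquiv h2 (det_redMat_formMatrix_ne_zero hc))
      (kerMod p M)).trans ?_
    exact finrank_kerMod_eq_two hd (formDet_normForm_ne_zero h0) (isCoprime_formDet_normForm hc) hM
  · rintro _ ⟨x, hx, rfl⟩
    obtain ⟨x, rfl⟩ := redVec_surjective p x
    rw [extForm_coordMap_redVec hc, ZMod.intCast_zmod_eq_zero_iff_dvd]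
    exact dvd_mul_of_dvd_right (dvd_of_redVec_mem_kerMod hM hx) 4

theorem exists_Rep_of_isSingularPlane (hc : IsCoprime (p : ℤ) (formDet q))
    {W : Submodule (ZMod p) (ZMod p × (Fin 3 → ZMod p))}
    (hW : IsSingularPlane (redMat p (formMatrix q)) W) :
    ∃ (n' : IntForm 4) (M : Matrix (Fin 4) (Fin 4) ℤ), Similar (normForm q) n' ∧
      M ∈ Rep n' ((p : ℤ) • normForm q) ∧
      (kerMod p M).map (coordMap (redMat p (formMatrix q))) = W := by
  have h2 := two_ne_zero_of_isCoprime hc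
  have hd := det_redMat_formMatrix_ne_zero hc
  let φ := coordEquiv h2 hd
  obtain ⟨n', M, hs, hM, hk⟩ := exists_Rep_of_singular (isCoprime_formDet_normForm hc)
    (W := W.comap φ.toLinearMap)
    (by
      have e : W.comap φ.toLinearMap = W.map φ.symm.toLinearMap :=
        (Submodule.map_equiv_eq_comap_symm φ.symm W).symm
      rw [← hW.1, e]
      exact LinearEquiv.finrank_map_eq φ.symm W)
    (fun x hx => by
      have h := hW.2 _ hx
      change extForm _ (coordMap _ (redVec p x)) = 0 at h
      rw [extForm_coordMap_redVec hc] at h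
      push_cast at h
      have h4 : (4 : ZMod p) ≠ 0 := by
        rw [show (4 : ZMod p) = 2 * 2 by norm_num]; exact mul_ne_zero h2 h2
      exact (ZMod.intCast_zmod_eq_zero_iff_dvd _ p).mp ((mul_eq_zero.mp h).resolve_left h4))
  refine ⟨n', M, hs, hM, ?_⟩
  rw [hk]
  exact Submodule.map_comap_eq_of_surjective φ.surjective W

/-- Divisibility of the lift in terms of the kernels modulo `p`. -/
theorem rightDivides_liftPsi_iff (h0 : formDet q ≠ 0) (hc : IsCoprime (p : ℤ) (formDet q))
    {q₁ : IntForm 3} {n₁ : IntForm 4} {A : Matrix (Fin 3) (Fin 3) ℤ}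
    {M : Matrix (Fin 4) (Fin 4) ℤ} (hd : formDet q₁ = formDet q)
    (hd' : formDet n₁ = formDet (normForm q)) (hA : A ∈ Rep q₁ ((p : ℤ) ^ 2 • q))
    (hM : M ∈ Rep n₁ ((p : ℤ) • normForm q)) :
    RightDivides M (liftPsi p hA) ↔
      ∀ x ∈ (kerMod p M).map (coordMap (redMat p (formMatrix q))), x.2 ∈ kerMod p A := by
  obtain ⟨M', h1, h2⟩ := exists_conjugate hd' (formDet_normForm_ne_zero h0)
    (isCoprime_formDet_normForm hc) hM
  obtain ⟨P, hP, hker⟩ := exists_integral_lift hd h0 hc hA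
  rw [rightDivides_iff_of_integral hP h1 h2]
  have key : ∀ x, redVec p x ∈ kerMod p P ↔
      (coordMap (redMat p (formMatrix q)) (redVec p x)).2 ∈ kerMod p A := by
    intro x
    rw [hker, mem_kerMod]
    change _ ↔ redMat p A *ᵥ ((redMat p (formMatrix q)).det⁻¹ •
      (redMat p (formMatrix q)).adjugate *ᵥ redVec p (imPart x)) = 0
    rw [mulVec_smul, smul_eq_zero, or_iff_right (inv_ne_zero (det_redMat_formMatrix_ne_zero hc))]
  constructor
  · rintro h _ ⟨x, hx, rfl⟩
    obtain ⟨x, rfl⟩ := redVec_surjective p x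
    exact (key x).mp (h hx)
  · intro h x hx
    obtain ⟨x, rfl⟩ := redVec_surjective p x
    exact (key x).mpr (h _ ⟨_, hx, rfl⟩)

theorem mul_mem_PrimRep {m : ℕ} {q' q₁ r : IntForm m} {A : Matrix (Fin m) (Fin m) ℤ}
    (U : Matrix.GeneralLinearGroup (Fin m) ℤ) (hU : subst q₁ (U : Matrix (Fin m) (Fin m) ℤ) = q')
    (hA : A ∈ PrimRep q' r) : (U : Matrix (Fin m) (Fin m) ℤ) * A ∈ PrimRep q₁ r := by
  refine ⟨?_, fun d hd => hA.2 d fun i j => ?_⟩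
  · change subst q₁ _ = r
    rw [subst_mul, hU]
    exact hA.1
  · rw [eq_inv_mul_unit_mul U A, Matrix.mul_apply]
    exact Finset.dvd_sum fun k _ => dvd_mul_of_dvd_right (hd k j) _

variable {h H : ℕ} {f : Fin h → IntForm 3} {g : Fin H → IntForm 4}

/-- The kernel modulo `p` of the automorphs of a ternary class. -/
def ternaryKernel (α : TernaryClasses q f p) : Submodule (ZMod p) (Fin 3 → ZMod p) :=
  Quotient.lift (fun A : PrimRep (f α.1) ((p : ℤ) ^ 2 • q) =>
    kerMod p (A : Matrix (Fin 3) (Fin 3) ℤ))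
    (by
      rintro A D ⟨U, -, hU⟩
      change kerMod p (A : Matrix (Fin 3) (Fin 3) ℤ) = kerMod p (D : Matrix (Fin 3) (Fin 3) ℤ)
      rw [hU, kerMod_unit_mul]) α.2

/-- The kernel modulo `p` of the automorphs of a quaternary class, in the coordinates of
`coordMap`. -/
def quaternaryKernel (μ : QuaternaryClasses (normForm q) g p) :
    Submodule (ZMod p) (ZMod p × (Fin 3 → ZMod p)) :=
  Quotient.lift (fun M : Rep (g μ.1) ((p : ℤ) • normForm q) =>
    (kerMod p (M : Matrix (Fin 4) (Fin 4) ℤ)).map (coordMap (redMat p (formMatrix q))))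
    (by
      rintro A D ⟨U, -, hU⟩
      change (kerMod p (A : Matrix (Fin 4) (Fin 4) ℤ)).map _ =
        (kerMod p (D : Matrix (Fin 4) (Fin 4) ℤ)).map _
      rw [hU, kerMod_unit_mul]) μ.2

/-- Equal kernels give a unimodular factor; inequivalence within the complete system then forces the
two forms to coincide, and the factor is a unit of that form. -/
theorem ternaryKernel_injective (h0 : formDet q ≠ 0) (hc : IsCoprime (p : ℤ) (formDet q))
    (hf : IsCompleteSystem q f) :
    Function.Injective (ternaryKernel : TernaryClasses q f p → _) := by
  rintro ⟨i, α⟩ ⟨i', α'⟩ hαα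
  induction α using Quotient.inductionOn with | _ A
  induction α' using Quotient.inductionOn with | _ A'
  obtain ⟨hdet, U, hU⟩ := exists_unit_of_kerMod_eq_ternary (hf.similar i).1.symm
    (hf.similar i').1.symm h0 hc A.2 A'.2 hαα
  obtain ⟨rfl, hE⟩ := exists_unitGroup_of_complete hf A.2.1 A'.2.1 hdet U hU
  have hmk : (Quotient.mk _ A' : LeftClasses (f i) (PrimRep (f i) ((p : ℤ) ^ 2 • q))) = Quotient.mk _ A :=
    Quotient.sound (s := leftSetoid _ _) ⟨U, hE, hU⟩
  rw [hmk]

theorem quaternaryKernel_injective (h0 : formDet q ≠ 0) (hc : IsCoprime (p : ℤ) (formDet q))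
    (hg : IsCompleteSystem (normForm q) g) :
    Function.Injective (quaternaryKernel : QuaternaryClasses (normForm q) g p → _) := by
  rintro ⟨j, μ⟩ ⟨j', μ'⟩ hμμ
  induction μ using Quotient.inductionOn with | _ M
  induction μ' using Quotient.inductionOn with | _ M'
  have hk := Submodule.map_injective_of_injective (coordMap_injective
    (two_ne_zero_of_isCoprime hc) (det_redMat_formMatrix_ne_zero hc)) hμμ
  have hn0 := formDet_normForm_ne_zero h0
  obtain ⟨U, hU⟩ := exists_unit_of_kerMod_eq (hg.similar j).1.symm
    (hg.similar j').1.symm hn0 (isCoprime_formDet_normForm hc) M.2 M'.2 hk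
  have hdet : (M : Matrix (Fin 4) (Fin 4) ℤ).det ≠ 0 := by
    have := det_sq_of_mem_Rep M.2 (hg.similar j).1.symm hn0
    intro h5
    rw [h5] at this
    exact pow_ne_zero 4 prime_ne_zero (this.symm.trans (by norm_num))
  obtain ⟨rfl, hE⟩ := exists_unitGroup_of_complete hg M.2 M'.2 hdet U hU
  have hmk : (Quotient.mk _ M' : LeftClasses (g j) (Rep (g j) ((p : ℤ) • normForm q))) = Quotient.mk _ M :=
    Quotient.sound (s := leftSetoid _ _) ⟨U, hE, hU⟩
  rw [hmk]

/-- The neighbour construction gives a form similar to `q`; passing to its representative multiplies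
the automorph by a unimodular matrix and keeps the kernel. -/
theorem range_ternaryKernel (h0 : formDet q ≠ 0) (hc : IsCoprime (p : ℤ) (formDet q))
    (hf : IsCompleteSystem q f) :
    Set.range (ternaryKernel : TernaryClasses q f p → _) =
      {K | IsTangent (redMat p (formMatrix q)) K} := by
  ext K
  constructor
  · rintro ⟨⟨i, α⟩, rfl⟩
    induction α using Quotient.inductionOn with | _ A
    exact isTangent_kerMod (hf.similar i).1.symm h0 hc A.2
  · intro hK
    obtain ⟨q', A, hs, hA, rfl⟩ := exists_PrimRep_of_isTangent hc hK
    obtain ⟨i, U, hU⟩ := hf.complete q' hs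
    exact ⟨⟨i, Quotient.mk _ ⟨_, mul_mem_PrimRep U hU hA⟩⟩, kerMod_unit_mul p U A⟩

theorem range_quaternaryKernel (h0 : formDet q ≠ 0) (hc : IsCoprime (p : ℤ) (formDet q))
    (hg : IsCompleteSystem (normForm q) g) :
    Set.range (quaternaryKernel : QuaternaryClasses (normForm q) g p → _) =
      {W | IsSingularPlane (redMat p (formMatrix q)) W} := by
  ext W
  constructor
  · rintro ⟨⟨j, μ⟩, rfl⟩
    induction μ using Quotient.inductionOn with | _ M
    exact isSingularPlane_map_kerMod h0 hc (hg.similar j).1.symm M.2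
  · intro hW
    obtain ⟨n', M, hs, hM, rfl⟩ := exists_Rep_of_isSingularPlane hc hW
    obtain ⟨j, U, hU⟩ := hg.complete n' hs
    refine ⟨⟨j, Quotient.mk _ ⟨(U : Matrix (Fin 4) (Fin 4) ℤ) * M, ?_⟩⟩, ?_⟩
    · change subst (g j) _ = _
      rw [subst_mul, hU]
      exact hM
    · change (kerMod p ((U : Matrix (Fin 4) (Fin 4) ℤ) * M)).map _ = _
      rw [kerMod_unit_mul]

/-- The right side involves only invariants of the classes, so divisibility holds for all
representatives once it holds for some. -/
theorem classDivides_iff (h0 : formDet q ≠ 0) (hc : IsCoprime (p : ℤ) (formDet q))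
    (hf : IsCompleteSystem q f) (hg : IsCompleteSystem (normForm q) g)
    (μ : QuaternaryClasses (normForm q) g p) (α : TernaryClasses q f p) :
    ClassDivides μ α ↔ ∀ x ∈ quaternaryKernel μ, x.2 ∈ ternaryKernel α := by
  obtain ⟨i, α⟩ := α
  obtain ⟨j, μ⟩ := μ
  have hrel := fun (A : PrimRep (f i) ((p : ℤ) ^ 2 • q)) (M : Rep (g j) ((p : ℤ) • normForm q)) =>
    rightDivides_liftPsi_iff h0 hc (hf.similar i).1.symm (hg.similar j).1.symm A.2.1 M.2
  constructor
  · rintro ⟨(A : PrimRep (f i) ((p : ℤ) ^ 2 • q)), (M : Rep (g j) ((p : ℤ) • normForm q)), hA, hM,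
      hdiv⟩
    change Quotient.mk _ A = α at hA
    change Quotient.mk _ M = μ at hM
    subst hA hM
    exact (hrel A M).mp hdiv
  · induction α using Quotient.inductionOn with | _ A
    induction μ using Quotient.inductionOn with | _ M
    intro hx
    exact ⟨A, M, rfl, rfl, (hrel A M).mpr hx⟩

end Classes

end AutomorphLift

/-! ### The incidence count transferred to classes -/

open AutomorphLift in
theorem corollary6p8 (q : IntForm 3) (hq : formDet q ≠ 0)
    {h H : ℕ} (f : Fin h → IntForm 3) (hf : IsCompleteSystem q f)
    (g : Fin H → IntForm 4) (hg : IsCompleteSystem (normForm q) g)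
    (p : ℕ) (hp : p.Prime) (hpq : IsCoprime (p : ℤ) (formDet q)) :
    -- divisibility is a relation between classes: it can be tested on any representatives
    (∀ (i : Fin h) (j : Fin H) (A : PrimRep (f i) ((p : ℤ) ^ 2 • q))
        (M : Rep (g j) ((p : ℤ) • normForm q)),
      ClassDivides (⟨j, Quotient.mk _ M⟩ : QuaternaryClasses (normForm q) g p)
          (⟨i, Quotient.mk _ A⟩ : TernaryClasses q f p) ↔
        RightDivides (M : Matrix (Fin 4) (Fin 4) ℤ) (liftPsi p A.2.1)) ∧
    -- each quaternary class divides from the right the lift of exactly one ternary class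
    (∀ μ : QuaternaryClasses (normForm q) g p, ∃! α : TernaryClasses q f p, ClassDivides μ α) ∧
    -- each lift is divisible from the right by exactly two quaternary classes
    (∀ α : TernaryClasses q f p,
      {μ : QuaternaryClasses (normForm q) g p | ClassDivides μ α}.ncard = 2) ∧
    -- the quaternary classes are the disjoint union of these sets of divisors
    (Set.univ : Set (QuaternaryClasses (normForm q) g p)) =
        ⋃ α : TernaryClasses q f p, {μ | ClassDivides μ α} ∧
    Pairwise (fun α β : TernaryClasses q f p =>
      Disjoint {μ : QuaternaryClasses (normForm q) g p | ClassDivides μ α}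
        {μ | ClassDivides μ β}) := by
  have : Fact p.Prime := ⟨hp⟩
  have h2 := two_ne_zero_of_isCoprime hpq
  have hs : (redMat p (formMatrix q)).transpose = redMat p (formMatrix q) :=
    redMat_formMatrix_transpose q
  have hd := det_redMat_formMatrix_ne_zero hpq
  have hdiv := classDivides_iff hq hpq hf hg
  have htern := ternaryKernel_injective hq hpq hf
  have hquat := quaternaryKernel_injective hq hpq hg
  have hexu : ∀ μ : QuaternaryClasses (normForm q) g p,
      ∃! α : TernaryClasses q f p, ClassDivides μ α := by
    intro μ
    have hμ : IsSingularPlane (redMat p (formMatrix q)) (quaternaryKernel μ) := by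
      have : quaternaryKernel μ ∈ Set.range (quaternaryKernel (p := p) (q := q) (g := g)) :=
        ⟨μ, rfl⟩
      rwa [range_quaternaryKernel hq hpq hg] at this
    obtain ⟨K, ⟨hK, hKμ⟩, huniq⟩ := hμ.existsUnique_tangent h2 hs hd
    have hK' : K ∈ Set.range (ternaryKernel : TernaryClasses q f p → _) := by
      rw [range_ternaryKernel hq hpq hf]; exact hK
    obtain ⟨α, rfl⟩ := hK'
    refine ⟨α, (hdiv μ α).mpr hKμ, fun β hβ => htern (huniq _ ⟨?_, (hdiv μ β).mp hβ⟩)⟩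
    have : ternaryKernel β ∈ Set.range (ternaryKernel : TernaryClasses q f p → _) := ⟨β, rfl⟩
    rwa [range_ternaryKernel hq hpq hf] at this
  refine ⟨fun i j A M => ?_, hexu, fun α => ?_, ?_, fun α β hαβ => ?_⟩
  · rw [hdiv, rightDivides_liftPsi_iff hq hpq (hf.similar i).1.symm (hg.similar j).1.symm A.2.1 M.2]
    rfl
  · have hα : IsTangent (redMat p (formMatrix q)) (ternaryKernel α) := by
      have : ternaryKernel α ∈ Set.range (ternaryKernel : TernaryClasses q f p → _) := ⟨α, rfl⟩
      rwa [range_ternaryKernel hq hpq hf] at this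
    -- The divisors are counted through their kernels, which are exactly the singular planes over
    -- the tangent plane of `α`.
    rw [← hα.ncard_singularPlanes h2 hs hd, ← Set.ncard_image_of_injective _ hquat]
    congr 1
    ext W
    constructor
    · rintro ⟨μ, hμ, rfl⟩
      refine ⟨?_, (hdiv μ α).mp hμ⟩
      have : quaternaryKernel μ ∈ Set.range (quaternaryKernel (p := p) (q := q) (g := g)) :=
        ⟨μ, rfl⟩
      rwa [range_quaternaryKernel hq hpq hg] at this
    · rintro ⟨hW, hWα⟩
      have hW' : W ∈ Set.range (quaternaryKernel (p := p) (q := q) (g := g)) := by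
        rw [range_quaternaryKernel hq hpq hg]; exact hW
      obtain ⟨μ, rfl⟩ := hW'
      exact ⟨μ, (hdiv μ α).mpr hWα, rfl⟩
  · ext μ
    simp only [Set.mem_univ, Set.mem_iUnion, true_iff]
    exact (hexu μ).exists
  · exact Set.disjoint_left.mpr fun μ hα hβ => hαβ ((hexu μ).unique hα hβ)
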